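/- **Notation.** A partition $\Delta$ (of any integer $\ge 0$) is a finite multiset of positive integers; $m_i(\Delta)$ is the multiplicity of $i$, $l(\Delta)=\sum_i m_i(\Delta)$, $|\Delta|=\sum_i i\,m_i(\Delta)$, $\|\Delta\|=\prod_i i^{m_i(\Delta)}$, and sums of partitions are sums of multisets. For $|\Delta|\le n$ let $[\Delta,1^{n-|\Delta|}]$ be the partition of $n$ obtained by adding $n-|\Delta|$ parts equal to $1$. Put $p_\Delta=\prod_i p_i^{m_i(\Delta)}$ and $\frac{\partial}{\partial p_\Delta}=\prod_i\frac{\partial^{m_i(\Delta)}}{\partial p_i^{m_i(\Delta)}}$. **The algebra $\mathcal A_\infty$.** A partial permutation of $\{1,\dots,n\}$ is a pair $(E,f)$ with $E\subseteq\{1,\dots,n\}$ and $f$ a permutation of $E$; its type is the cycle type of $f$ on $E$, a partition of its degree $|E|$, and $(E_1,f_1)(E_2,f_2)=(E_1\cup E_2,f_1f_2)$. Let $\mathcal A_n$ be the algebra of the elements of the complex semigroup algebra of these pairs that are invariant under conjugation by $S_n$, and for $m\le n$ let $\theta_m:\mathcal A_n\to\mathcal A_m$ send $(E,f)$ to itself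 if $E\subseteq\{1,\dots,m\}$ and to $0$ otherwise. $\mathcal A_\infty$ is the algebra of the sequences $(x_n)_{n\ge 0}$, $x_n\in\mathcal A_n$, with $\theta_m(x_n)=x_m$ for $m\le n$ and with the degrees of the $(E,f)$ occurring in the $x_n$ bounded uniformly in $n$. $A_\Delta\in\mathcal A_\infty$ is the sequence whose $n$-th member is the sum of all partial permutations of $\{1,\dots,n\}$ of type $\Delta$. **The operators.** Let $CU_n(\Delta_1,\Delta_2,\Delta_3)$ be $\prod_{i=1}^3\binom{n-|\Delta_i|+m_1(\Delta_i)}{m_1(\Delta_i)}$ times the number of connected degree $n$ coverings of the sphere with ramification types $[\Delta_i,1^{n-|\Delta_i|}]$ over three given points and unramified elsewhere, each counted with weight $1/|\mathrm{Aut}|$, i.e. times $\frac1{n!}$ times the number of triples $(s_1,s_2,s_3)\in S_n^3$ with $s_i$ of cycle type $[\Delta_i,1^{n-|\Delta_i|}]$, $s_1s_2s_3=1$ and $\langle s_1,s_2,s_3\rangle$ transitive ($CU_n=0$ if $n=0$ or some $|\Delta_i|>n$). Let $R$ be a nonzero commutative $\mathbb C$-algebra and $z\in R$ a unit (for instance a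 nonzero complex number, or the indeterminate $z$ of $R=\mathbb C[z,z^{-1}]$). For a partition $\Delta$ define, on the polynomials in $p_1,p_2,\dots$ over $R$, $$W(\Delta,z)=\sum_{\{(\Gamma_i',\Delta^i,\Gamma_i)\}_i}\frac{z^{|\Delta|-l(\Delta)+l(\Gamma')-l(\Gamma)}}{|\mathrm{Aut}|}\Big(\prod_i\|\Gamma_i'\|\,\delta_{|\Gamma_i|,|\Gamma_i'|}\,CU_{|\Gamma_i'|}(\Gamma_i',\Delta^i,\Gamma_i)\Big)\,p_{\Gamma}\frac{\partial}{\partial p_{\Gamma'}},$$ where the sum runs over all finite multisets (possibly empty) of triples of partitions with $\sum_i\Delta^i=\Delta$ and all $|\Delta^i|\ge1$, where $\Gamma'=\sum_i\Gamma'_i$, $\Gamma=\sum_i\Gamma_i$, and where $|\mathrm{Aut}|$ is the product of the factorials of the multiplicities of the triples. Put $\hat W(\Delta,z)=z^{-|\Delta|+l(\Delta)}W(\Delta,z)$. **Characters.** For a Young diagram $\lambda$ with $|\lambda|$ cells let $\chi_\lambda$ and $\dim\lambda$ be the character and the dimension of the corresponding irreducible representation of $S_{|\lambda|}$. Let $\phi_\lambda(\Delta)=0$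 if $|\Delta|>|\lambda|$ and otherwise $$\phi_\lambda(\Delta)=\binom{|\lambda|-|\Delta|+m_1(\Delta)}{m_1(\Delta)}\frac{1}{\dim\lambda}\,|C|\,\chi_\lambda(C),$$ with $C$ the conjugacy class of cycle type $[\Delta,1^{|\lambda|-|\Delta|}]$. Let $$S_\lambda\{p,z\}=\sum_{|\Gamma|=|\lambda|}z^{-|\Gamma|-l(\Gamma)}\frac{\dim\lambda}{|\lambda|!}\,\phi_\lambda(\Gamma)\,p_\Gamma .$$ **Corollary 4.6.** The elements $A_\Delta$ form a $\mathbb C$-basis of $\mathcal A_\infty$; let $\hat C_{\Delta_1,\Delta_2}^{\Delta_3}\in\mathbb C$ be the structure constants of $\mathcal A_\infty$ in this basis. For all $R$ and $z$ as above the following holds. 1. The $\mathbb C$-span $\mathcal W_\infty$ of the operators $\hat W(\Delta,z)$, for all partitions $\Delta$, is a unital commutative associative algebra under composition, and $\hat W(\Delta_1,z)\hat W(\Delta_2,z)=\sum_{\Delta_3}\hat C_{\Delta_1,\Delta_2}^{\Delta_3}\hat W(\Delta_3,z)$; these structure constants do not depend on $z$. 2. There is an isomorphism of $\mathbb C$-algebras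 $\mathcal W_\infty\cong\mathcal A_\infty$ with $\hat W(\Delta,z)\mapsto A_\Delta$ for every $\Delta$. 3. For every Young diagram $\lambda$ one has $S_\lambda\{p,z\}\ne0$, and $\hat W(\Delta,z)\,S_\lambda\{p,z\}=\phi_\lambda(\Delta)\,S_\lambda\{p,z\}$ for every partition $\Delta$. -/

import Mathlib

open scoped Nat

namespace ShiftedW

noncomputable section

/-! ### Partitions -/

/-- A partition (of an arbitrary nonnegative integer) is a finite multiset of positive integers,
its parts. The sum of two partitions is the sum of multisets, `m_i(Δ)` is `Δ.count i` and the
length `l(Δ)` is `Multiset.card Δ`. -/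
abbrev Ptn : Type := Multiset ℕ+

/-- `|Δ|`, the sum of the parts. -/
def size (Δ : Ptn) : ℕ := (Δ.map (fun i : ℕ+ => (i : ℕ))).sum

/-- `||Δ||`, the product of the parts. -/
def normProd (Δ : Ptn) : ℕ := (Δ.map (fun i : ℕ+ => (i : ℕ))).prod

/-- The shifting `[Δ, 1^(n-|Δ|)]` of `Δ`; it is a partition of `n` exactly when `|Δ| ≤ n`. -/
def shift (n : ℕ) (Δ : Ptn) : Ptn := Δ + Multiset.replicate (n - size Δ) 1

/-- The binomial coefficient `(n - |Δ| + m_1(Δ) choose m_1(Δ))`, to be used for `|Δ| ≤ n`. -/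
def shiftBinom (n : ℕ) (Δ : Ptn) : ℕ := (n - size Δ + Δ.count 1).choose (Δ.count 1)

/-- The permutation `σ` has cycle type `Δ`, fixed points being counted as cycles of length one. -/
def HasType {α : Type*} [Fintype α] [DecidableEq α] (σ : Equiv.Perm α) (Δ : Ptn) : Prop :=
  σ.partition.parts = Δ.map (fun i : ℕ+ => (i : ℕ))

/-! ### Partial permutations and the algebra `A_∞` -/

/-- A partial permutation: a finite set `supp` of points together with a permutation of `supp`,
the latter being extended by the identity outside `supp`. The points are labelled by `ℕ`. -/
@[ext] structure PartialPerm where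
  supp : Finset ℕ
  perm : Equiv.Perm ℕ
  fix : ∀ x, x ∉ supp → perm x = x

namespace PartialPerm

theorem perm_mem_iff (a : PartialPerm) (x : ℕ) : a.perm x ∈ a.supp ↔ x ∈ a.supp := by
  constructor
  · intro h
    by_contra hx
    rw [a.fix x hx] at h
    exact hx h
  · intro h
    by_contra hx
    exact hx (by rwa [a.perm.injective (a.fix _ hx)])

/-- `(E₁, f₁)(E₂, f₂) = (E₁ ∪ E₂, f₁ f₂)`, with unit `(∅, e)`. -/
instance : Monoid PartialPerm where
  mul a b := ⟨a.supp ∪ b.supp, a.perm * b.perm, fun x hx => by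
    rw [Finset.mem_union, not_or] at hx
    rw [Equiv.Perm.mul_apply, b.fix x hx.2, a.fix x hx.1]⟩
  one := ⟨∅, 1, fun _ _ => rfl⟩
  mul_assoc a b c := PartialPerm.ext (Finset.union_assoc _ _ _) (mul_assoc _ _ _)
  one_mul a := PartialPerm.ext (Finset.empty_union _) (one_mul _)
  mul_one a := PartialPerm.ext (Finset.union_empty _) (mul_one _)

@[simp] theorem supp_mul (a b : PartialPerm) : (a * b).supp = a.supp ∪ b.supp := rfl
@[simp] theorem perm_mul (a b : PartialPerm) : (a * b).perm = a.perm * b.perm := rfl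
@[simp] theorem supp_one : (1 : PartialPerm).supp = ∅ := rfl
@[simp] theorem perm_one : (1 : PartialPerm).perm = 1 := rfl

/-- The permutation of the support. -/
def restr (a : PartialPerm) : Equiv.Perm {x // x ∈ a.supp} :=
  a.perm.subtypePerm a.perm_mem_iff

/-- The partial permutation has cycle type `Δ` on its support (so that the support has `|Δ|`
elements). -/
def IsOfType (a : PartialPerm) (Δ : Ptn) : Prop := HasType a.restr Δ

/-- `(E, f) ↦ (vE, v f v⁻¹)`. -/
def conj (v : Equiv.Perm ℕ) (a : PartialPerm) : PartialPerm :=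
  ⟨a.supp.map v.toEmbedding, v * a.perm * v⁻¹, fun x hx => by
    have h : v⁻¹ x ∉ a.supp := fun h => hx (Finset.mem_map.2 ⟨_, h, by simp⟩)
    rw [Equiv.Perm.mul_apply, Equiv.Perm.mul_apply, a.fix _ h]
    exact v.apply_symm_apply x⟩

end PartialPerm

/-- The semigroup `P_n` of partial permutations of the set of `n` points `{0, …, n - 1}`. -/
def PP (n : ℕ) : Submonoid PartialPerm where
  carrier := {a | a.supp ⊆ Finset.range n}
  mul_mem' ha hb := Finset.union_subset ha hb
  one_mem' := Finset.empty_subset _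

/-- The semigroup algebra `B_n = ℂ[P_n]`. -/
abbrev BAlg (n : ℕ) : Type := MonoidAlgebra ℂ (PP n)

/-- The symmetric group `S_n`, as the permutations of `ℕ` that fix every `x ≥ n`. -/
def Sym (n : ℕ) : Subgroup (Equiv.Perm ℕ) where
  carrier := {v | ∀ x, n ≤ x → v x = x}
  mul_mem' {v w} hv hw x hx := by rw [Equiv.Perm.mul_apply, hw x hx, hv x hx]
  one_mem' _ _ := rfl
  inv_mem' {v} hv x hx := by rw [Equiv.Perm.inv_eq_iff_eq, hv x hx]

theorem conj_mem {n : ℕ} (v : Sym n) {a : PartialPerm} (ha : a ∈ PP n) :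
    a.conj v ∈ PP n := by
  intro x hx
  obtain ⟨y, hy, rfl⟩ := Finset.mem_map.1 hx
  have hyn : y < n := Finset.mem_range.1 (ha hy)
  rw [Finset.mem_range]
  by_contra h
  have h1 : (v : Equiv.Perm ℕ) ((v : Equiv.Perm ℕ) y) = (v : Equiv.Perm ℕ) y :=
    v.2 _ (not_lt.1 h)
  have h2 : (v : Equiv.Perm ℕ) y = y := (v : Equiv.Perm ℕ).injective h1
  exact h (by simpa [h2] using hyn)

/-- The action of `v ∈ S_n` on `P_n`. -/
def conjHom {n : ℕ} (v : Sym n) : PP n →* PP n where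
  toFun a := ⟨a.1.conj v, conj_mem v a.2⟩
  map_one' := Subtype.ext (PartialPerm.ext (by simp [PartialPerm.conj])
    (by simp [PartialPerm.conj]))
  map_mul' a b := Subtype.ext (PartialPerm.ext
    (by simp [PartialPerm.conj, Finset.map_union]) (by simp [PartialPerm.conj, mul_assoc]))

/-- The algebra `A_n` of the elements of `B_n` that are invariant under `S_n`. -/
def AAlg (n : ℕ) : Subalgebra ℂ (BAlg n) :=
  ⨅ v : Sym n, AlgHom.equalizer (MonoidAlgebra.mapDomainAlgHom ℂ ℂ (conjHom v))
    (AlgHom.id ℂ (BAlg n))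

open Classical in
/-- The algebra homomorphism `θ_m : B_n → B_m`, which sends `(E, f)` to itself if `E` is contained
in the set of the first `m` points and to `0` otherwise. -/
def theta (n m : ℕ) : BAlg n →ₐ[ℂ] BAlg m :=
  MonoidAlgebra.lift ℂ (BAlg m) (PP n)
    { toFun := fun a => if h : a.1 ∈ PP m then MonoidAlgebra.single ⟨a.1, h⟩ 1 else 0
      map_one' := by
        exact (dif_pos (PP m).one_mem).trans rfl
      map_mul' := fun a b => by
        by_cases ha : a.1 ∈ PP m
        · by_cases hb : b.1 ∈ PP m
          · rw [dif_pos ha, dif_pos hb, dif_pos (show (a * b).1 ∈ PP m from (PP m).mul_mem ha hb),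
              MonoidAlgebra.single_mul_single, mul_one]
            rfl
          · rw [dif_neg hb, dif_neg, mul_zero]
            exact fun h => hb (Finset.union_subset_right h)
        · rw [dif_neg ha, dif_neg, zero_mul]
          exact fun h => ha (Finset.union_subset_left h) }

/-- The algebra `A_∞`: the projective limit of the algebras `A_n` along the maps `θ_m`, taken
degreewise, so that its elements are the compatible sequences of bounded degree, where
the degree of `(E, f)` is the number of elements of `E`. -/
def AInf : Subalgebra ℂ (∀ n, BAlg n) where
  carrier := {x | (∀ n, x n ∈ AAlg n) ∧ (∀ m n, m ≤ n → theta n m (x n) = x m) ∧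
    ∃ d : ℕ, ∀ n, ∀ a : PP n, (x n).coeff a ≠ 0 → a.1.supp.card ≤ d}
  mul_mem' := by
    rintro x y ⟨hx1, hx2, d, hx3⟩ ⟨hy1, hy2, e, hy3⟩
    refine ⟨fun n => (AAlg n).mul_mem (hx1 n) (hy1 n), fun m n h => ?_, d + e, fun n a ha => ?_⟩
    · rw [Pi.mul_apply, map_mul, hx2 m n h, hy2 m n h, Pi.mul_apply]
    · classical
      have hs := MonoidAlgebra.support_coeff_mul_subset (x n) (y n) (Finsupp.mem_support_iff.2 ha)
      obtain ⟨b, hb, c, hc, rfl⟩ := Finset.mem_mul.1 hs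
      exact (Finset.card_union_le _ _).trans (add_le_add (hx3 n b (Finsupp.mem_support_iff.1 hb))
        (hy3 n c (Finsupp.mem_support_iff.1 hc)))
  add_mem' := by
    rintro x y ⟨hx1, hx2, d, hx3⟩ ⟨hy1, hy2, e, hy3⟩
    refine ⟨fun n => (AAlg n).add_mem (hx1 n) (hy1 n), fun m n h => ?_, max d e, fun n a ha => ?_⟩
    · rw [Pi.add_apply, map_add, hx2 m n h, hy2 m n h, Pi.add_apply]
    · by_cases h : (x n).coeff a = 0
      · refine (hy3 n a fun h' => ha ?_).trans (le_max_right _ _)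
        simp [h, h']
      · exact (hx3 n a h).trans (le_max_left _ _)
  algebraMap_mem' := by
    intro r
    refine ⟨fun n => (AAlg n).algebraMap_mem r, fun m n _ => ?_, 0, fun n a ha => ?_⟩
    · exact (theta n m).commutes r
    · have : a = 1 := by
        by_contra h
        apply ha
        simp [Pi.algebraMap_apply, MonoidAlgebra.coeff_single, Ne.symm h]
      subst this
      simp

instance (n : ℕ) : Finite (PP n) := by
  let G : PP n → Finset.powerset (Finset.range n) × (Fin n → Fin n → Prop) :=
    fun a => (⟨a.1.supp, Finset.mem_powerset.2 a.2⟩, fun i k => a.1.perm i = k)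
  refine Finite.of_injective G fun a b hab => ?_
  have h1 : a.1.supp = b.1.supp := congrArg (fun t => (t.1 : Finset ℕ)) hab
  have h2 : ∀ i k : Fin n, (a.1.perm i = k) = (b.1.perm i = k) := fun i k =>
    congrFun (congrFun (congrArg Prod.snd hab) i) k
  refine Subtype.ext (PartialPerm.ext h1 (Equiv.ext fun x => ?_))
  by_cases hx : x ∈ a.1.supp
  · have hxn : x < n := Finset.mem_range.1 (a.2 hx)
    have hyn : a.1.perm x < n := Finset.mem_range.1 (a.2 ((a.1.perm_mem_iff x).2 hx))
    exact ((h2 ⟨x, hxn⟩ ⟨_, hyn⟩).mp rfl).symm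
  · rw [a.1.fix x hx, b.1.fix x (h1 ▸ hx)]

instance (n : ℕ) : Fintype (PP n) := Fintype.ofFinite _

open Classical in
/-- The class `A_{Δ;n}`, the sum of all partial permutations of `n` points of type `Δ`. -/
def classSum (n : ℕ) (Δ : Ptn) : BAlg n :=
  ∑ a : PP n with a.1.IsOfType Δ, MonoidAlgebra.single a 1

theorem classSum_coeff (n : ℕ) (Δ : Ptn) (a : PP n) [Decidable (a.1.IsOfType Δ)] :
    (classSum n Δ).coeff a = if a.1.IsOfType Δ then 1 else 0 := by
  classical
  simp [classSum, MonoidAlgebra.coeff_sum, MonoidAlgebra.coeff_single, Finsupp.single_apply,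
    Finset.sum_ite_eq']

theorem hasType_permCongr {α β : Type*} [Fintype α] [DecidableEq α] [Fintype β] [DecidableEq β]
    (e : α ≃ β) (σ : Equiv.Perm α) (Δ : Ptn) : HasType (e.permCongr σ) Δ ↔ HasType σ Δ := by
  have h : e.permCongr σ = σ.extendDomain (e.trans (Equiv.Set.univ β).symm) := by
    ext x
    rw [show x = ((e.trans (Equiv.Set.univ β).symm) (e.symm x) : β) by simp,
      Equiv.Perm.extendDomain_apply_image]
    simp
  have h1 : (e.permCongr σ).cycleType = σ.cycleType := by
    rw [h]
    exact Equiv.Perm.cycleType_extendDomain _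
  rw [HasType, HasType, Equiv.Perm.parts_partition, Equiv.Perm.parts_partition,
    ← Equiv.Perm.sum_cycleType, ← Equiv.Perm.sum_cycleType, h1, Fintype.card_congr e]

theorem PartialPerm.isOfType_conj (v : Equiv.Perm ℕ) (a : PartialPerm) (Δ : Ptn) :
    (a.conj v).IsOfType Δ ↔ a.IsOfType Δ := by
  have hmem : ∀ x, x ∈ a.supp ↔ v x ∈ (a.conj v).supp := fun x => by
    simp [PartialPerm.conj]
  have h : (a.conj v).restr = (v.subtypeEquiv hmem).permCongr a.restr := by
    exact Equiv.ext fun x => Subtype.ext rfl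
  rw [PartialPerm.IsOfType, h, hasType_permCongr, PartialPerm.IsOfType]

theorem PartialPerm.isOfType_card {a : PartialPerm} {Δ : Ptn} (h : a.IsOfType Δ) :
    a.supp.card = size Δ := by
  have := congrArg Multiset.sum h
  rw [Nat.Partition.parts_sum, Fintype.card_coe] at this
  exact this

theorem classSum_mem_AAlg (n : ℕ) (Δ : Ptn) : classSum n Δ ∈ AAlg n := by
  classical
  refine Algebra.mem_iInf.2 fun v => ?_
  change MonoidAlgebra.mapDomainAlgHom ℂ ℂ (conjHom v) (classSum n Δ) = classSum n Δ
  have hinj : Function.Injective (conjHom v) := by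
    intro a b hab
    have h0 : a.1.conj v = b.1.conj v := congrArg Subtype.val hab
    have h1 := congrArg PartialPerm.supp h0
    have h2 := congrArg PartialPerm.perm h0
    simp only [PartialPerm.conj, mul_left_inj, mul_right_inj] at h1 h2
    exact Subtype.ext (PartialPerm.ext (Finset.map_injective _ h1) h2)
  have hbij : Function.Bijective (conjHom v) := Finite.injective_iff_bijective.1 hinj
  rw [classSum, map_sum]
  refine Finset.sum_bijective (conjHom v) hbij (fun a => ?_) (fun a _ => ?_)
  · simp only [Finset.mem_filter, Finset.mem_univ, true_and]
    exact (PartialPerm.isOfType_conj v a.1 Δ).symm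
  · exact MonoidAlgebra.mapDomain_single

theorem theta_classSum {m n : ℕ} (hmn : m ≤ n) (Δ : Ptn) :
    theta n m (classSum n Δ) = classSum m Δ := by
  classical
  have hle : PP m ≤ PP n := fun a ha x hx =>
    Finset.mem_range.2 ((Finset.mem_range.1 (ha hx)).trans_le hmn)
  rw [classSum, map_sum, classSum]
  symm
  refine Finset.sum_of_injOn (Submonoid.inclusion hle)
    (Submonoid.inclusion_injective hle).injOn (fun a ha => ?_) (fun b hb hb' => ?_)
    (fun a ha => ?_)
  · simpa using ha
  · rw [theta, MonoidAlgebra.lift_single, one_smul]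
    refine dif_neg fun h => hb' ⟨⟨b.1, h⟩, ?_, rfl⟩
    simpa using hb
  · rw [theta, MonoidAlgebra.lift_single, one_smul]
    symm
    exact dif_pos _

/-- The element `A_Δ` of `A_∞`, the (formal) sum of all partial permutations of type `Δ`. -/
def AElt (Δ : Ptn) : AInf :=
  ⟨fun n => classSum n Δ, fun n => classSum_mem_AAlg n Δ, fun _ _ h => theta_classSum h Δ,
    size Δ, fun n a ha => by
      classical
      rw [classSum_coeff] at ha
      exact (PartialPerm.isOfType_card (by_contra fun h => ha (if_neg h))).le⟩

/-! ### Irreducible characters of the symmetric groups and the functions `φ_λ` -/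

/-- The symmetric group `S_{|λ|}`, as the permutation group of the cells of `λ`. -/
abbrev CellPerm (lam : YoungDiagram) : Type := Equiv.Perm {c // c ∈ lam.cells}

open Classical in
/-- The Young symmetrizer `(∑ r) (∑ sgn(c) c)`, where `r` runs over the permutations that preserve
the row of every cell and `c` over those that preserve the column of every cell. -/
def youngSymmetrizer (lam : YoungDiagram) : MonoidAlgebra ℂ (CellPerm lam) :=
  (∑ r : CellPerm lam with ∀ x, (r x).1.1 = x.1.1, MonoidAlgebra.single r 1) *
    ∑ c : CellPerm lam with ∀ x, (c x).1.2 = x.1.2,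
      MonoidAlgebra.single c ((Equiv.Perm.sign c : ℤ) : ℂ)

/-- The irreducible representation of `S_{|λ|}` corresponding to `λ`: the left ideal of the group
algebra generated by the Young symmetrizer. -/
abbrev spechtModule (lam : YoungDiagram) : Ideal (MonoidAlgebra ℂ (CellPerm lam)) :=
  Ideal.span {youngSymmetrizer lam}

/-- `dim λ`. -/
def dimIrr (lam : YoungDiagram) : ℕ := Module.finrank ℂ (spechtModule lam)

/-- The character `χ_λ`. -/
def chi (lam : YoungDiagram) (σ : CellPerm lam) : ℂ :=
  LinearMap.trace ℂ (spechtModule lam)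
    (Algebra.lsmul ℂ ℂ (spechtModule lam) (MonoidAlgebra.single σ (1 : ℂ)))

open Classical in
/-- The normalized character `φ_λ(Δ)`. The character being constant on the conjugacy class
`C_{Δ;|λ|}` of the permutations of cycle type `[Δ, 1^(|λ|-|Δ|)]`, the product of `|C_{Δ;|λ|}|` with
its value on the class is written as its sum over the class. -/
def phi (lam : YoungDiagram) (Δ : Ptn) : ℂ :=
  if size Δ ≤ lam.card then
    (shiftBinom lam.card Δ : ℂ) * (1 / (dimIrr lam : ℂ)) *
      ∑ σ : CellPerm lam with HasType σ (shift lam.card Δ), chi lam σ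
  else 0

/-! ### The shifted genus expanded cut-and-join operators -/

/-- The connected shifted Hurwitz number of the sphere, in degree `n`, for three branch points with
ramification `[Δ_i, 1^(n-|Δ_i|)]`: the number of connected coverings, each counted with weight one
over the number of its automorphisms, times the binomial coefficients. The coverings are given by
their monodromy, and connectedness means that the monodromy group is transitive on the `n ≥ 1`
sheets. The genus of the covering surface is determined by the Riemann-Hurwitz formula. -/
def connHurwitz (n : ℕ) (Δ₁ Δ₂ Δ₃ : Ptn) : ℂ :=
  ((shiftBinom n Δ₁ * shiftBinom n Δ₂ * shiftBinom n Δ₃ : ℕ) : ℂ) *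
    (Nat.card {s : Equiv.Perm (Fin n) × Equiv.Perm (Fin n) × Equiv.Perm (Fin n) //
      HasType s.1 (shift n Δ₁) ∧ HasType s.2.1 (shift n Δ₂) ∧ HasType s.2.2 (shift n Δ₃) ∧
      s.1 * s.2.1 * s.2.2 = 1 ∧ n ≠ 0 ∧
      MulAction.IsPretransitive (Subgroup.closure {s.1, s.2.1, s.2.2}) (Fin n)} : ℂ) / (n ! : ℂ)

/-- The triples `(Γ', Δ, Γ)` of partitions. -/
abbrev Triple : Type := Ptn × Ptn × Ptn

/-- The sum of the partitions `Γ'_i` of an (unordered) series of triples `(Γ'_i, Δ^i, Γ_i)`. -/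
def srcSum (T : Multiset Triple) : Ptn := (T.map (fun t => t.1)).sum

/-- The sum of the partitions `Δ^i`. -/
def midSum (T : Multiset Triple) : Ptn := (T.map (fun t => t.2.1)).sum

/-- The sum of the partitions `Γ_i`. -/
def tgtSum (T : Multiset Triple) : Ptn := (T.map (fun t => t.2.2)).sum

/-- The (unordered) series of triples `(Γ'_i, Δ^i, Γ_i)` for which `(Δ^i)_i` is a proper
re-partition of `Δ`: the sum of the `Δ^i` is `Δ` and every `|Δ^i|` is at least one. -/
def ReSeries (Δ : Ptn) : Type :=
  {T : Multiset Triple // midSum T = Δ ∧ ∀ t ∈ T, 1 ≤ size t.2.1}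

open Classical in
/-- The number of automorphisms of a series of triples, that is, of the permutations of its
indices that permute equal triples among themselves. -/
def autCard (T : Multiset Triple) : ℕ := ∏ t ∈ T.toFinset, (T.count t)!

/-- The numerical factor
`∏_i (||Γ'_i|| δ_{|Γ_i|,|Γ'_i|} CU_0(Γ'_i, Δ^i, Γ_i)) / |Aut|` of a series of triples. -/
def seriesCoeff (T : Multiset Triple) : ℂ :=
  (T.map (fun t => (normProd t.1 : ℂ) * (if size t.2.2 = size t.1 then 1 else 0) *
    connHurwitz (size t.1) t.1 t.2.1 t.2.2)).prod / (autCard T : ℂ)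

section Finiteness

theorem multiset_finite {α : Type*} {S : Set α} (hS : S.Finite) (k : ℕ) :
    {T : Multiset α | (∀ t ∈ T, t ∈ S) ∧ T.card ≤ k}.Finite := by
  classical
  refine (Set.finite_Iic (k • hS.toFinset.val)).subset fun T hT => ?_
  rw [Set.mem_Iic, Multiset.le_iff_count]
  intro t
  by_cases ht : t ∈ T
  · rw [Multiset.count_nsmul, Multiset.count_eq_one_of_mem hS.toFinset.nodup
      (hS.mem_toFinset.2 (hT.1 t ht)), mul_one]
    exact (Multiset.count_le_card t T).trans hT.2
  · rw [Multiset.count_eq_zero_of_notMem ht]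
    exact Nat.zero_le _

theorem card_le_size (Γ : Ptn) : Γ.card ≤ size Γ := by
  induction Γ using Multiset.induction_on with
  | empty => simp
  | cons i Γ ih =>
    have := i.pos
    simp only [size, Multiset.card_cons, Multiset.map_cons, Multiset.sum_cons] at ih ⊢
    omega

theorem size_add (Γ Δ : Ptn) : size (Γ + Δ) = size Γ + size Δ := by
  simp [size]

theorem size_mono {Γ Δ : Ptn} (h : Γ ≤ Δ) : size Γ ≤ size Δ := by
  obtain ⟨E, rfl⟩ := Multiset.le_iff_exists_add.1 h
  rw [size_add]
  exact Nat.le_add_right _ _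

theorem size_finite (N : ℕ) : {Γ : Ptn | size Γ ≤ N}.Finite := by
  refine (multiset_finite (Set.finite_Iic (N.succPNat)) N).subset fun Γ hΓ =>
    ⟨fun i hi => ?_, (card_le_size Γ).trans hΓ⟩
  have h : size {i} ≤ size Γ := size_mono (Multiset.singleton_le.2 hi)
  have h' : (i : ℕ) ≤ N := by
    have h0 := h.trans hΓ
    rwa [size, Multiset.map_singleton, Multiset.sum_singleton] at h0
  exact (PNat.coe_le_coe _ _).1 (h'.trans (Nat.le_succ N))

theorem card_le_size_midSum (T : Multiset Triple) (hT : ∀ t ∈ T, 1 ≤ size t.2.1) :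
    T.card ≤ size (midSum T) := by
  induction T using Multiset.induction_on with
  | empty => simp
  | cons t T ih =>
    have h1 := ih fun s hs => hT s (Multiset.mem_cons_of_mem hs)
    have h2 := hT t (Multiset.mem_cons_self t T)
    simp only [midSum, Multiset.card_cons, Multiset.map_cons, Multiset.sum_cons, size_add] at h1 ⊢
    omega

variable {R : Type*} [CommRing R]

/-- The monomial `p_Γ`. -/
def pMon (R : Type*) [CommRing R] (Γ : Ptn) : MvPolynomial ℕ+ R :=
  (Γ.map MvPolynomial.X).prod

/-- The differential operator `∂/∂p_Γ`, the product of the operators `∂/∂p_i` over the parts `i`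
of `Γ` (these operators commute). -/
def pDiff (Γ : Ptn) : Module.End R (MvPolynomial ℕ+ R) :=
  (Γ.sort.map (fun i => (MvPolynomial.pderiv i).toLinearMap)).prod

theorem list_pderiv_monomial (l : List ℕ+) (m : ℕ+ →₀ ℕ) (r : R) :
    ∃ (c : R) (m' : ℕ+ →₀ ℕ),
      (l.map (fun i => ((MvPolynomial.pderiv i).toLinearMap :
        Module.End R (MvPolynomial ℕ+ R)))).prod (MvPolynomial.monomial m r) =
          MvPolynomial.monomial m' c ∧
      (c ≠ 0 → ∀ i, m' i + l.count i = m i) := by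
  induction l with
  | nil => exact ⟨r, m, rfl, fun _ _ => by simp⟩
  | cons j l ih =>
    obtain ⟨c, m', h1, h2⟩ := ih
    refine ⟨c * (m' j : R), m' - Finsupp.single j 1, ?_, fun hc i => ?_⟩
    · rw [List.map_cons, List.prod_cons, Module.End.mul_apply, h1]
      exact MvPolynomial.pderiv_monomial
    · have hc1 : c ≠ 0 := fun h => hc (by simp [h])
      have hj : m' j ≠ 0 := fun h => hc (by simp [h])
      have := h2 hc1 i
      by_cases hij : j = i
      · subst hij
        simp
        omega
      · simp [hij]
        omega

theorem pDiff_finite (f : MvPolynomial ℕ+ R) : {Γ : Ptn | pDiff Γ f ≠ 0}.Finite := by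
  classical
  refine (f.support.finite_toSet.biUnion fun m _ =>
    Set.finite_Iic (Finsupp.toMultiset m)).subset fun Γ hΓ => ?_
  rw [Set.mem_ofPred_eq, f.as_sum, map_sum] at hΓ
  obtain ⟨m, hm, hne⟩ := Finset.exists_ne_zero_of_sum_ne_zero hΓ
  refine Set.mem_biUnion (Finset.mem_coe.2 hm) ?_
  obtain ⟨c, m', h1, h2⟩ := list_pderiv_monomial Γ.sort m (f.coeff m)
  have hc : c ≠ 0 := fun h => hne (by rw [pDiff, h1, h, MvPolynomial.monomial_zero])
  rw [Set.mem_Iic, Multiset.le_iff_count]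
  intro i
  have h3 := h2 hc i
  have h4 : Γ.sort.count i = Γ.count i := by
    rw [← Multiset.coe_count, Multiset.sort_eq]
  rw [Finsupp.count_toMultiset]
  omega

theorem series_finite (Δ : Ptn) (f : MvPolynomial ℕ+ R) :
    {T : ReSeries Δ | seriesCoeff T.1 ≠ 0 ∧ pDiff (srcSum T.1) f ≠ 0}.Finite := by
  classical
  obtain ⟨N, hN⟩ : ∃ N, ∀ Γ, pDiff Γ f ≠ 0 → size Γ ≤ N := by
    obtain ⟨N, hN⟩ := ((pDiff_finite f).image size).bddAbove
    exact ⟨N, fun Γ h => hN ⟨Γ, h, rfl⟩⟩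
  have hS := (size_finite N).prod ((Set.finite_Iic Δ).prod (size_finite N))
  refine Set.Finite.of_finite_image (f := Subtype.val) ?_ Subtype.val_injective.injOn
  refine (multiset_finite hS (size Δ)).subset ?_
  rintro _ ⟨⟨T, hT1, hT2⟩, ⟨h1, h2⟩, rfl⟩
  refine ⟨fun t ht => ?_, hT1 ▸ card_le_size_midSum T hT2⟩
  have h3 : size t.1 ≤ N := (size_mono
    (Multiset.single_le_sum (fun _ _ => bot_le) _ (Multiset.mem_map_of_mem _ ht))).trans (hN _ h2)
  have h4 : t.2.1 ≤ Δ := hT1 ▸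
    (Multiset.single_le_sum (fun _ _ => bot_le) _ (Multiset.mem_map_of_mem _ ht))
  have h5 : size t.2.2 = size t.1 := by
    by_contra h
    refine h1 ?_
    rw [seriesCoeff, Multiset.prod_eq_zero, zero_div]
    exact Multiset.mem_map.2 ⟨t, ht, by rw [if_neg h, mul_zero, zero_mul]⟩
  exact ⟨h3, h4, h5.trans_le h3⟩

end Finiteness

section Operators

variable {R : Type*} [CommRing R] [Algebra ℂ R]

/-- The term of the operator `W(Δ, z)` given by a series of triples, applied to `f`; the normal
ordering puts all the `p_i` in front of all the `∂/∂p_j`. -/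
def WTerm (z : Rˣ) (Δ : Ptn) (T : ReSeries Δ) (f : MvPolynomial ℕ+ R) : MvPolynomial ℕ+ R :=
  ((z ^ ((size Δ : ℤ) - Δ.card + (srcSum T.1).card - (tgtSum T.1).card) : Rˣ) : R) •
    seriesCoeff T.1 • (pMon R (tgtSum T.1) * pDiff (srcSum T.1) f)

theorem WTerm_finite (z : Rˣ) (Δ : Ptn) (f : MvPolynomial ℕ+ R) :
    (fun T : ReSeries Δ => WTerm z Δ T f).HasFiniteSupport := by
  refine (series_finite Δ f).subset fun T hT => ?_
  rw [Function.mem_support] at hT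
  constructor
  · intro h
    exact hT (by rw [WTerm, h, zero_smul, smul_zero])
  · intro h
    exact hT (by rw [WTerm, h, mul_zero, smul_zero, smul_zero])

/-- The shifted genus expanded cut-and-join operator `W(Δ, z)` on the polynomials in the
time-variables `p_1, p_2, …`; applied to a polynomial, only finitely many of its terms are
nonzero. -/
def W (z : Rˣ) (Δ : Ptn) : Module.End R (MvPolynomial ℕ+ R) where
  toFun f := ∑ᶠ T : ReSeries Δ, WTerm z Δ T f
  map_add' f g := by
    rw [← finsum_add_distrib (WTerm_finite z Δ f) (WTerm_finite z Δ g)]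
    refine finsum_congr fun T => ?_
    simp only [WTerm, map_add, mul_add, smul_add]
  map_smul' c f := by
    rw [RingHom.id_apply, smul_finsum' c (WTerm_finite z Δ f)]
    refine finsum_congr fun T => ?_
    simp only [WTerm, map_smul, mul_smul_comm, smul_comm c]

/-- The normalized operator `z^(-|Δ|+l(Δ)) W(Δ, z)`. -/
def What (z : Rˣ) (Δ : Ptn) : Module.End R (MvPolynomial ℕ+ R) :=
  ((z ^ (-(size Δ : ℤ) + Δ.card) : Rˣ) : R) • W z Δ

/-- The algebra `W_∞` over `ℂ` generated by the normalized operators, with the composition as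
product. -/
def WInf (z : Rˣ) : Subalgebra ℂ (Module.End R (MvPolynomial ℕ+ R)) :=
  Algebra.adjoin ℂ (Set.range (What z))

theorem What_mem (z : Rˣ) (Δ : Ptn) : What z Δ ∈ WInf z :=
  Algebra.subset_adjoin (Set.mem_range_self Δ)

/-- The genus expanded Schur function `S_λ{p, z}`, a sum over the partitions of `|λ|`. -/
def genusSchur (z : Rˣ) (lam : YoungDiagram) : MvPolynomial ℕ+ R :=
  ∑ Γ ∈ (size_finite lam.card).toFinset with size Γ = lam.card,
    ((z ^ (-(size Γ : ℤ) - Γ.card) : Rˣ) : R) •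
      ((dimIrr lam : ℂ) / (lam.card ! : ℂ) * phi lam Γ) • pMon R Γ

end Operators

end

end ShiftedW

/-!
The operators are the image of a faithful representation of `A_∞`. Write `P_Γ = z^(-l(Γ)) p_Γ`
(`zMon`), so that `z` disappears from `What z Δ`, and let a permutation `s` of `n` points stand for
`P_Γ` with `Γ` its cycle type. The heart of the proof is `What_zMon_ctype`: the operator `What z Δ`
sends `s` to the sum of the products `s f` over all partial permutations `(E, f)` of type `Δ` of
the `n` points.

This is an instance of the exponential formula. A pair `(s, (E, f))` is the disjoint union of its
restrictions to the orbits of `⟨s, f⟩`, and the cycle types of `s`, `f` and `s f` are additive, so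
the sum over all pairs is a sum over multisets of types of transitive pairs (`sum_permPairs_eq`,
proved by splitting off the orbit of one point). Transitive pairs are counted by the connected
Hurwitz numbers (`card_connPairs`); the binomial coefficient there is the number of choices of `E`
for given `f` (`card_support_superset`). The orbits that do not meet `E` are single cycles of `s`;
these correspond to the factors of `P_Γ` that are not differentiated (`bijOn_add_idTriple`,
`What_zMon`), and the centralizer order `∏ i^(m_i) m_i!` passes from the sum over all `s` of a given
type to a single `s`.

The `A_Δ` form a basis of `A_∞` because partial permutations of the same type are conjugate, and
`A_∞` is commutative because invariant elements of `ℂ[P_n]` are central (`AAlg_comm`). Hence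
`A_Δ ↦ What z Δ` is multiplicative (`actLin_mul`), and it is injective since the images of the
powers of `p_1` determine all coefficients (`act_injective`).

Finally, `S_λ` is up to a nonzero factor the image of `∑ χ_λ(σ) σ` (`genusSchur_eq`), and a central
element of the group algebra multiplies this sum by the scalar by which it acts on the irreducible
representation. That it acts by a scalar follows from von Neumann's lemma on Young symmetrizers
(`IsRowColInvariant.eq`) without an appeal to irreducibility.
-/

set_option linter.unusedSectionVars false

namespace ShiftedW

noncomputable section

open Equiv Finset

/-! ### Cycle types of permutations of finite sets -/

section CycleType

variable {α : Type*} [Fintype α] [DecidableEq α]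

/-- The cycle type, on the finite set `S`, of a permutation `f` supported in `S`: fixed points of
`f` in `S` are counted as cycles of length one. -/
def ctype (S : Finset α) (f : Perm α) : Ptn :=
  f.cycleType.map Nat.toPNat' + Multiset.replicate (#S - #f.support) 1

theorem map_coe_toPNat' {m : Multiset ℕ} (h : ∀ i ∈ m, 0 < i) :
    (m.map Nat.toPNat').map (fun i : ℕ+ => (i : ℕ)) = m := by
  rw [Multiset.map_map]
  conv_rhs => rw [← Multiset.map_id m]
  refine Multiset.map_congr rfl fun i hi => ?_
  simp [Nat.toPNat'_coe, h i hi]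

theorem map_coe_cycleType (f : Perm α) :
    (f.cycleType.map Nat.toPNat').map (fun i : ℕ+ => (i : ℕ)) = f.cycleType :=
  map_coe_toPNat' fun _ hi => zero_lt_one.trans (Perm.one_lt_of_mem_cycleType hi)

theorem map_coe_ctype (S : Finset α) (f : Perm α) :
    (ctype S f).map (fun i : ℕ+ => (i : ℕ)) =
      f.cycleType + Multiset.replicate (#S - #f.support) 1 := by
  rw [ctype, Multiset.map_add, map_coe_cycleType, Multiset.map_replicate]
  rfl

theorem map_coe_injective :
    Function.Injective (Multiset.map (fun i : ℕ+ => (i : ℕ))) :=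
  Multiset.map_injective PNat.coe_injective

theorem hasType_iff (f : Perm α) (Δ : Ptn) : HasType f Δ ↔ ctype univ f = Δ := by
  rw [HasType, Perm.parts_partition, ← map_coe_injective.eq_iff, map_coe_ctype, card_univ]

theorem size_replicate_one (k : ℕ) : size (Multiset.replicate k 1) = k := by
  simp [size]

theorem size_cycleType (f : Perm α) : size (f.cycleType.map Nat.toPNat') = #f.support := by
  rw [size, map_coe_cycleType, Perm.sum_cycleType]

theorem size_ctype {S : Finset α} {f : Perm α} (h : f.support ⊆ S) : size (ctype S f) = #S := by
  rw [ctype, size_add, size_cycleType, size_replicate_one, Nat.add_sub_cancel' (card_le_card h)]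

theorem size_ctype_univ (f : Perm α) : size (ctype univ f) = Fintype.card α :=
  size_ctype (subset_univ _)

theorem ctype_mul {S T : Finset α} {f g : Perm α} (hf : f.support ⊆ S) (hg : g.support ⊆ T)
    (h : Disjoint S T) : ctype (S ∪ T) (f * g) = ctype S f + ctype T g := by
  have hd : f.Disjoint g := Perm.disjoint_iff_disjoint_support.2 (h.mono hf hg)
  have h1 := card_le_card hf
  have h2 := card_le_card hg
  rw [ctype, hd.cycleType_mul, hd.card_support_mul, card_union_of_disjoint h, Multiset.map_add,
    ctype, ctype, show #S + #T - (#f.support + #g.support) =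
      (#S - #f.support) + (#T - #g.support) by omega, Multiset.replicate_add]
  abel

theorem ctype_inv (S : Finset α) (f : Perm α) : ctype S f⁻¹ = ctype S f := by
  rw [ctype, ctype, Perm.cycleType_inv, Perm.support_inv]

theorem ctype_one (S : Finset α) : ctype S (1 : Perm α) = Multiset.replicate #S 1 := by
  simp [ctype]

theorem ctype_subset {S T : Finset α} {f : Perm α} (hf : f.support ⊆ S) (h : S ⊆ T) :
    ctype T f = ctype S f + Multiset.replicate (#T - #S) 1 := by
  have h1 := card_le_card hf
  have h2 := card_le_card h
  rw [ctype, ctype, add_assoc, ← Multiset.replicate_add]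
  congr 2
  omega

theorem ctype_univ_eq_iff_isConj (f g : Perm α) : ctype univ f = ctype univ g ↔ IsConj f g := by
  rw [Perm.partition_eq_of_isConj, Nat.Partition.ext_iff, ← hasType_iff, HasType,
    (hasType_iff g (ctype univ g)).2 rfl]

theorem hasType_subtypePerm {S : Finset α} {f : Perm α} (hf : f.support ⊆ S)
    (h : ∀ x, f x ∈ S ↔ x ∈ S) (Δ : Ptn) :
    HasType (f.subtypePerm h : Perm {x // x ∈ S}) Δ ↔ ctype S f = Δ := by
  have h0 : Perm.ofSubtype (f.subtypePerm h : Perm {x // x ∈ S}) = f :=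
    Perm.ofSubtype_subtypePerm h fun x hx => hf (Perm.mem_support.2 hx)
  have h1 : (f.subtypePerm h : Perm {x // x ∈ S}).cycleType = f.cycleType := by
    rw [← Perm.cycleType_ofSubtype, h0]
  rw [hasType_iff, ctype, ctype, ← Perm.sum_cycleType, ← Perm.sum_cycleType, h1, card_univ,
    Fintype.card_coe]

theorem one_notMem_cycleType (f : Perm α) : (1 : ℕ+) ∉ f.cycleType.map Nat.toPNat' := by
  intro h
  have h1 := Multiset.mem_map_of_mem (fun i : ℕ+ => (i : ℕ)) h
  rw [map_coe_cycleType] at h1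
  exact (Perm.one_lt_of_mem_cycleType h1).ne' rfl

/-- Two partitions written as a part without ones and a number of ones. -/
theorem add_replicate_one_inj {a b : Ptn} (ha : (1 : ℕ+) ∉ a) (hb : (1 : ℕ+) ∉ b) {k l : ℕ} :
    a + Multiset.replicate k 1 = b + Multiset.replicate l 1 ↔ a = b ∧ k = l := by
  refine ⟨fun h => ?_, fun h => by rw [h.1, h.2]⟩
  have hkl : k = l := by
    have := congrArg (Multiset.count 1) h
    simpa [Multiset.count_eq_zero_of_notMem ha, Multiset.count_eq_zero_of_notMem hb] using this
  subst hkl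
  exact ⟨add_right_cancel h, rfl⟩

theorem exists_eq_add_replicate_one (Δ : Ptn) :
    ∃ a : Ptn, (1 : ℕ+) ∉ a ∧ Δ = a + Multiset.replicate (Δ.count 1) 1 := by
  refine ⟨Δ.filter (· ≠ 1), by simp, ?_⟩
  conv_lhs => rw [← Multiset.filter_add_not (· ≠ 1) Δ]
  simp [Multiset.filter_eq']

/-- `∏ m_i(Δ)!`. -/
def mfac (Δ : Ptn) : ℕ := ∏ i ∈ Δ.toFinset, (Δ.count i)!

theorem mfac_pos (Δ : Ptn) : 0 < mfac Δ := prod_pos fun _ _ => Nat.factorial_pos _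

theorem mfac_eq_prod {Δ : Ptn} {s : Finset ℕ+} (h : Δ.toFinset ⊆ s) :
    mfac Δ = ∏ i ∈ s, (Δ.count i)! :=
  prod_subset h fun i _ hi => by
    rw [Multiset.count_eq_zero_of_notMem (fun h => hi (Multiset.mem_toFinset.2 h)),
      Nat.factorial_zero]

theorem mfac_cons (i : ℕ+) (Δ : Ptn) : mfac (i ::ₘ Δ) = (Δ.count i + 1) * mfac Δ := by
  have h1 : i ∈ (i ::ₘ Δ).toFinset := by simp
  rw [mfac, mfac_eq_prod (s := (i ::ₘ Δ).toFinset) (by simp), ← mul_prod_erase _ _ h1,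
    ← mul_prod_erase _ _ h1, ← mul_assoc, Multiset.count_cons_self, Nat.factorial_succ]
  congr 1
  refine prod_congr rfl fun j hj => ?_
  rw [Multiset.count_cons_of_ne (ne_of_mem_erase hj)]

theorem mfac_add_replicate_one {a : Ptn} (ha : (1 : ℕ+) ∉ a) (k : ℕ) :
    mfac (a + Multiset.replicate k 1) = mfac a * k ! := by
  induction k with
  | zero => simp
  | succ k ih =>
    rw [Multiset.replicate_succ, Multiset.add_cons, mfac_cons, ih, Multiset.count_add,
      Multiset.count_eq_zero_of_notMem ha, Multiset.count_replicate_self, Nat.factorial_succ]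
    ring

/-- The centralizer order `∏ i^(m_i) m_i!` times the size of the conjugacy class is `n!`. -/
theorem card_class_mul {Γ : Ptn} (h : size Γ = Fintype.card α) :
    #{f : Perm α | ctype univ f = Γ} * (normProd Γ * mfac Γ) = (Fintype.card α)! := by
  obtain ⟨a, ha, haΓ⟩ := exists_eq_add_replicate_one Γ
  set k := Γ.count 1
  have hsz : size a + k = Fintype.card α := by
    rw [← h, haΓ, size_add, size_replicate_one]
  have h2 : ∀ i ∈ a.map (fun i : ℕ+ => (i : ℕ)), 2 ≤ i := by
    intro i hi
    obtain ⟨j, hj, rfl⟩ := Multiset.mem_map.1 hi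
    have : j ≠ 1 := fun h => ha (h ▸ hj)
    have h1 : (j : ℕ) ≠ 1 := fun h => this (PNat.coe_eq_one_iff.1 h)
    have := j.pos
    omega
  have key := Perm.card_of_cycleType_mul_eq α (a.map (fun i : ℕ+ => (i : ℕ)))
  rw [if_pos ⟨by rw [← hsz]; exact Nat.le_add_right _ _, h2⟩] at key
  rw [← key]
  have e1 : (Finset.univ.filter fun f : Perm α => ctype univ f = Γ) =
      Finset.univ.filter fun f : Perm α => f.cycleType = a.map (fun i : ℕ+ => (i : ℕ)) := by
    ext f
    simp only [mem_filter, mem_univ, true_and]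
    rw [haΓ, ctype, add_replicate_one_inj (one_notMem_cycleType f) ha, ← map_coe_injective.eq_iff,
      map_coe_cycleType]
    refine and_iff_left_of_imp fun hf => ?_
    rw [← Perm.sum_cycleType, hf, card_univ, ← hsz, size]
    omega
  have e2 : Fintype.card α - (a.map (fun i : ℕ+ => (i : ℕ))).sum = k := by
    rw [← hsz, size]
    omega
  have e3 : ∏ n ∈ (a.map (fun i : ℕ+ => (i : ℕ))).toFinset,
      ((a.map (fun i : ℕ+ => (i : ℕ))).count n)! = mfac a := by
    rw [Multiset.toFinset_map, prod_image PNat.coe_injective.injOn, mfac]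
    refine prod_congr rfl fun i _ => ?_
    rw [Multiset.count_map_eq_count' _ _ PNat.coe_injective]
  rw [e1, e2, e3, haΓ, mfac_add_replicate_one ha, normProd, Multiset.map_add, Multiset.prod_add]
  simp only [Multiset.map_replicate, PNat.one_coe, Multiset.prod_replicate, one_pow]
  ring

/-- A permutation of type `[Δ, 1^(n-|Δ|)]` underlies `(n-|Δ|+m_1(Δ) choose m_1(Δ))` partial
permutations of type `Δ`. -/
theorem card_support_superset {S : Finset α} {f : Perm α} (hf : f.support ⊆ S) (Δ : Ptn) :
    #{E : Finset α | E ⊆ S ∧ f.support ⊆ E ∧ ctype E f = Δ} =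
      if ctype S f = shift #S Δ then shiftBinom #S Δ else 0 := by
  split_ifs with h
  · have hsz : size Δ ≤ #S := by
      have := congrArg size h
      rw [size_ctype hf, shift, size_add, size_replicate_one] at this
      omega
    obtain ⟨a, ha, haΔ⟩ := exists_eq_add_replicate_one Δ
    set k := Δ.count 1
    have hsz2 : size Δ = size a + k := by rw [haΔ, size_add, size_replicate_one]
    have h' := h
    rw [shift, haΔ, add_assoc, ← Multiset.replicate_add, ← haΔ, ctype,
      add_replicate_one_inj (one_notMem_cycleType f) ha] at h'
    have hsz3 : size a = #f.support := by rw [← h'.1, size_cycleType]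
    have hS := card_le_card hf
    have : shiftBinom #S Δ = #(powersetCard k (S \ f.support)) := by
      rw [card_powersetCard, shiftBinom, card_sdiff_of_subset hf]
      congr 1
      change _ + k = _
      omega
    rw [this]
    symm
    refine card_bij (fun E _ => E ∪ f.support) (fun E hE => ?_) (fun E hE E' hE' hEE => ?_)
      (fun E hE => ?_)
    · rw [mem_powersetCard] at hE
      have hd : Disjoint E f.support := disjoint_of_subset_left hE.1 sdiff_disjoint
      simp only [mem_filter, mem_univ, true_and]
      refine ⟨union_subset (hE.1.trans sdiff_subset) hf, subset_union_right, ?_⟩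
      rw [ctype, card_union_of_disjoint hd, hE.2, Nat.add_sub_cancel, h'.1, ← haΔ]
    · rw [mem_powersetCard] at hE hE'
      have hd : Disjoint E f.support := disjoint_of_subset_left hE.1 sdiff_disjoint
      have hd' : Disjoint E' f.support := disjoint_of_subset_left hE'.1 sdiff_disjoint
      rw [← union_sdiff_cancel_right hd, hEE, union_sdiff_cancel_right hd']
    · simp only [mem_filter, mem_univ, true_and] at hE
      refine ⟨E \ f.support, ?_, sdiff_union_of_subset hE.2.1⟩
      rw [mem_powersetCard, card_sdiff_of_subset hE.2.1]
      refine ⟨sdiff_subset_sdiff hE.1 le_rfl, ?_⟩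
      have h3 := hE.2.2
      rw [haΔ, ctype, add_replicate_one_inj (one_notMem_cycleType f) ha] at h3
      exact h3.2
  · rw [card_eq_zero, filter_eq_empty_iff]
    rintro E - ⟨hE, hfE, rfl⟩
    exact h (by rw [shift, size_ctype hfE, ctype_subset hfE hE])

end CycleType

/-! ### Pairs of a permutation and a partial permutation, and their orbits -/

section Structures

variable {α : Type*} [Fintype α] [DecidableEq α]

/-- The triples `(s, E, f)` of a permutation `s` of `S` and a partial permutation `(E, f)` of `S`,
permutations of a subset being extended by the identity. -/
def permPairs (S : Finset α) : Finset (Perm α × Finset α × Perm α) :=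
  {x | x.1.support ⊆ S ∧ x.2.1 ⊆ S ∧ x.2.2.support ⊆ x.2.1}

/-- The cycle types of `s` on `S`, of `f` on `E`, and of `s f` on `S`. -/
def pairType (S : Finset α) (x : Perm α × Finset α × Perm α) : Triple :=
  (ctype S x.1, ctype x.2.1 x.2.2, ctype S (x.1 * x.2.2))

/-- `C` is a union of orbits of the group generated by `s` and `f`. -/
def IsInvariant (C : Finset α) (s f : Perm α) : Prop :=
  ∀ a, (s a ∈ C ↔ a ∈ C) ∧ (f a ∈ C ↔ a ∈ C)

/-- `B` is nonempty and has no proper nonempty subset invariant under `s` and `f`. -/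
def IsConn (B : Finset α) (s f : Perm α) : Prop :=
  B.Nonempty ∧ ∀ C ⊆ B, C.Nonempty → IsInvariant C s f → C = B

open Classical in
/-- The elements of `permPairs B` for which `s` and `f` act transitively on `B ≠ ∅`. -/
def connPairs (B : Finset α) : Finset (Perm α × Finset α × Perm α) :=
  {x ∈ permPairs B | IsConn B x.1 x.2.2}

theorem mem_permPairs {S : Finset α} {x : Perm α × Finset α × Perm α} :
    x ∈ permPairs S ↔ x.1.support ⊆ S ∧ x.2.1 ⊆ S ∧ x.2.2.support ⊆ x.2.1 := by
  simp [permPairs]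

theorem mem_connPairs {S : Finset α} {x : Perm α × Finset α × Perm α} :
    x ∈ connPairs S ↔ x ∈ permPairs S ∧ IsConn S x.1 x.2.2 := by
  simp [connPairs]

theorem apply_eq_of_notMem {B : Finset α} {f : Perm α} (hf : f.support ⊆ B) {a : α} (ha : a ∉ B) :
    f a = a :=
  Perm.notMem_support.1 fun h => ha (hf h)

theorem apply_mem_iff {B : Finset α} {f : Perm α} (hf : f.support ⊆ B) (a : α) :
    f a ∈ B ↔ a ∈ B := by
  by_cases h : f a = a
  · rw [h]
  · have h1 : a ∈ f.support := Perm.mem_support.2 h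
    exact iff_of_true (hf (Perm.apply_mem_support.2 h1)) (hf h1)

theorem apply_mem_iff_of_disjoint {B : Finset α} {f : Perm α} (hf : Disjoint f.support B) (a : α) :
    f a ∈ B ↔ a ∈ B := by
  have := apply_mem_iff (f := f) (B := Bᶜ) (fun x hx => by
    rw [mem_compl]; exact Finset.disjoint_left.1 hf hx) a
  simpa using not_congr this

theorem mul_apply_of_mem {B : Finset α} {f g : Perm α} (hg : Disjoint g.support B) {a : α}
    (ha : a ∈ B) : (f * g) a = f a := by
  rw [Perm.mul_apply, Perm.notMem_support.1 (Finset.disjoint_right.1 hg ha)]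

theorem mul_apply_mem_iff {B : Finset α} {f g : Perm α} (hf : f.support ⊆ B)
    (hg : Disjoint g.support B) (a : α) : (f * g) a ∈ B ↔ a ∈ B := by
  rw [Perm.mul_apply, apply_mem_iff hf, apply_mem_iff_of_disjoint hg]

theorem eq_of_mul_eq_mul {B : Finset α} {f g f' g' : Perm α} (hf : f.support ⊆ B)
    (hg : Disjoint g.support B) (hf' : f'.support ⊆ B) (hg' : Disjoint g'.support B)
    (h : f * g = f' * g') : f = f' ∧ g = g' := by
  have : f = f' := by
    ext a
    by_cases ha : a ∈ B
    · rw [← mul_apply_of_mem hg ha, h, mul_apply_of_mem hg' ha]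
    · rw [apply_eq_of_notMem hf ha, apply_eq_of_notMem hf' ha]
  subst this
  exact ⟨rfl, mul_left_cancel h⟩

theorem exists_mul_of_invariant {B : Finset α} {f : Perm α} (h : ∀ a, f a ∈ B ↔ a ∈ B) :
    ∃ g k : Perm α, g * k = f ∧ g.support ⊆ f.support ∩ B ∧ k.support ⊆ f.support \ B := by
  set g : Perm α := Perm.ofSubtype (f.subtypePerm h : Perm {x // x ∈ B}) with hg
  have h1 : ∀ a ∈ B, g a = f a := fun a ha => by
    rw [hg, Perm.ofSubtype_apply_of_mem _ ha]
    rfl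
  have h2 : ∀ a, a ∉ B → g a = a := fun a ha => by
    rw [hg, Perm.ofSubtype_apply_of_not_mem _ ha]
  refine ⟨g, g⁻¹ * f, by group, fun a ha => ?_, fun a ha => ?_⟩
  · rw [Perm.mem_support] at ha
    by_cases hB : a ∈ B
    · rw [h1 a hB] at ha
      exact mem_inter.2 ⟨Perm.mem_support.2 ha, hB⟩
    · exact absurd (h2 a hB) ha
  · rw [Perm.mem_support, Perm.mul_apply, Ne, Perm.inv_eq_iff_eq] at ha
    by_cases hB : a ∈ B
    · exact absurd (h1 a hB).symm ha
    · rw [h2 a hB] at ha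
      exact mem_sdiff.2 ⟨Perm.mem_support.2 ha, hB⟩

theorem IsInvariant.inter {B C : Finset α} {s f : Perm α} (hB : IsInvariant B s f)
    (hC : IsInvariant C s f) : IsInvariant (B ∩ C) s f := fun a => by
  simp only [mem_inter, (hB a).1, (hB a).2, (hC a).1, (hC a).2, and_self]

theorem IsInvariant.sdiff {B C : Finset α} {s f : Perm α} (hB : IsInvariant B s f)
    (hC : IsInvariant C s f) : IsInvariant (B \ C) s f := fun a => by
  simp only [mem_sdiff, (hB a).1, (hB a).2, (hC a).1, (hC a).2, and_self]

/-- Every point of an invariant set lies in a connected invariant subset, its orbit. -/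
theorem exists_isConn {S : Finset α} {s f : Perm α} (hS : IsInvariant S s f) {a : α} (ha : a ∈ S) :
    ∃ B ⊆ S, a ∈ B ∧ IsInvariant B s f ∧ IsConn B s f := by
  classical
  have hne : (S.powerset.filter fun B => a ∈ B ∧ IsInvariant B s f).Nonempty :=
    ⟨S, mem_filter.2 ⟨mem_powerset.2 le_rfl, ha, hS⟩⟩
  obtain ⟨B, hB, hmin⟩ := exists_min_image _ card hne
  rw [mem_filter, mem_powerset] at hB
  refine ⟨B, hB.1, hB.2.1, hB.2.2, ⟨a, hB.2.1⟩, fun C hC hCne hCinv => ?_⟩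
  by_cases haC : a ∈ C
  · exact eq_of_subset_of_card_le hC
      (hmin C (mem_filter.2 ⟨mem_powerset.2 (hC.trans hB.1), haC, hCinv⟩))
  · exfalso
    have h1 := hmin (B \ C) (mem_filter.2 ⟨mem_powerset.2 (sdiff_subset.trans hB.1),
      mem_sdiff.2 ⟨hB.2.1, haC⟩, hB.2.2.sdiff hCinv⟩)
    rw [card_sdiff_of_subset hC] at h1
    have h2 := card_le_card hC
    have h3 := hCne.card_pos
    omega

theorem isInvariant_congr {C : Finset α} {s f s' f' : Perm α} (hs : ∀ a ∈ C, s a = s' a)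
    (hf : ∀ a ∈ C, f a = f' a) (h : IsInvariant C s f) : IsInvariant C s' f' := by
  have key : ∀ g g' : Perm α, (∀ a ∈ C, g a = g' a) → (∀ a, g a ∈ C ↔ a ∈ C) →
      ∀ a, g' a ∈ C ↔ a ∈ C := by
    intro g g' hg hC a
    refine ⟨fun ha => ?_, fun ha => by rw [← hg a ha]; exact (hC a).2 ha⟩
    -- `b` is the preimage under `g` of `g' a`
    obtain ⟨b, hb⟩ := g.surjective (g' a)
    have hbC : b ∈ C := (hC b).1 (hb ▸ ha)
    have : a = b := g'.injective (by rw [← hb, hg b hbC])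
    exact this ▸ hbC
  exact fun a => ⟨key s s' hs (fun a => (h a).1) a, key f f' hf (fun a => (h a).2) a⟩

theorem isConn_congr {B : Finset α} {s f s' f' : Perm α} (hs : ∀ a ∈ B, s a = s' a)
    (hf : ∀ a ∈ B, f a = f' a) (h : IsConn B s f) : IsConn B s' f' :=
  ⟨h.1, fun C hC hne hinv => h.2 C hC hne (isInvariant_congr (fun a ha => (hs a (hC ha)).symm)
    (fun a ha => (hf a (hC ha)).symm) hinv)⟩

/-- Splitting off the orbit `B` of the point `a`. -/
theorem sum_permPairs {M : Type*} [AddCommMonoid M] (F : Triple → M) {S : Finset α} {a : α}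
    (ha : a ∈ S) :
    ∑ x ∈ permPairs S, F (pairType S x) =
      ∑ B ∈ S.powerset with a ∈ B, ∑ y ∈ connPairs B, ∑ z ∈ permPairs (S \ B),
        F (pairType B y + pairType (S \ B) z) := by
  symm
  simp_rw [← sum_product', sum_sigma']
  have aux : ∀ {p : Σ _ : Finset α, (Perm α × Finset α × Perm α) × (Perm α × Finset α × Perm α)},
      p ∈ (S.powerset.filter (a ∈ ·)).sigma (fun B => connPairs B ×ˢ permPairs (S \ B)) →
      p.1 ⊆ S ∧ a ∈ p.1 ∧ p.2.1.1.support ⊆ p.1 ∧ p.2.1.2.1 ⊆ p.1 ∧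
        p.2.1.2.2.support ⊆ p.2.1.2.1 ∧ IsConn p.1 p.2.1.1 p.2.1.2.2 ∧
        p.2.2.1.support ⊆ S \ p.1 ∧ p.2.2.2.1 ⊆ S \ p.1 ∧ p.2.2.2.2.support ⊆ p.2.2.2.1 := by
    intro p hp
    simpa only [mem_sigma, mem_filter, mem_powerset, mem_product, mem_connPairs, mem_permPairs,
      and_assoc] using hp
  refine sum_bij (fun p _ => (p.2.1.1 * p.2.2.1, p.2.1.2.1 ∪ p.2.2.2.1, p.2.1.2.2 * p.2.2.2.2))
    (fun p hp => ?_) (fun p hp q hq h => ?_) (fun x hx => ?_) (fun p hp => ?_)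
  · obtain ⟨hB, -, h1, h2, h3, -, h4, h5, h6⟩ := aux hp
    rw [mem_permPairs]
    exact ⟨(Perm.support_mul_le _ _).trans (union_subset (h1.trans hB) (h4.trans sdiff_subset)),
      union_subset (h2.trans hB) (h5.trans sdiff_subset),
      (Perm.support_mul_le _ _).trans (union_subset_union h3 h6)⟩
  · obtain ⟨hB, ha, h1, h2, h3, hc, h4, h5, h6⟩ := aux hp
    obtain ⟨hB', ha', h1', h2', h3', hc', h4', h5', h6'⟩ := aux hq
    obtain ⟨B, ⟨s, E, f⟩, ⟨s₁, E₁, f₁⟩⟩ := p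
    obtain ⟨B', ⟨s', E', f'⟩, ⟨s₁', E₁', f₁'⟩⟩ := q
    simp only [Prod.mk.injEq] at h hB ha h1 h2 h3 hc h4 h5 h6 hB' ha' h1' h2' h3' hc' h4' h5' h6'
    obtain ⟨e1, e2, e3⟩ := h
    have d1 : Disjoint s₁.support B := disjoint_of_subset_left h4 sdiff_disjoint
    have d2 : Disjoint f₁.support B := disjoint_of_subset_left (h6.trans h5) sdiff_disjoint
    have d1' : Disjoint s₁'.support B' := disjoint_of_subset_left h4' sdiff_disjoint
    have d2' : Disjoint f₁'.support B' := disjoint_of_subset_left (h6'.trans h5') sdiff_disjoint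
    have i1 : IsInvariant B (s * s₁) (f * f₁) := fun a =>
      ⟨mul_apply_mem_iff h1 d1 a, mul_apply_mem_iff (h3.trans h2) d2 a⟩
    have i2 : IsInvariant B' (s * s₁) (f * f₁) := by
      rw [e1, e3]
      exact fun a => ⟨mul_apply_mem_iff h1' d1' a, mul_apply_mem_iff (h3'.trans h2') d2' a⟩
    have c1 : IsConn B (s * s₁) (f * f₁) := isConn_congr
      (fun a ha => (mul_apply_of_mem d1 ha).symm) (fun a ha => (mul_apply_of_mem d2 ha).symm) hc
    have c2 : IsConn B' (s * s₁) (f * f₁) := by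
      rw [e1, e3]
      exact isConn_congr (fun a ha => (mul_apply_of_mem d1' ha).symm)
        (fun a ha => (mul_apply_of_mem d2' ha).symm) hc'
    -- both `B` and `B'` are the orbit of `a`
    have hne : (B ∩ B').Nonempty := ⟨a, mem_inter.2 ⟨ha, ha'⟩⟩
    have hBB : B = B' := (c1.2 _ inter_subset_left hne (i1.inter i2)).symm.trans
      (c2.2 _ inter_subset_right hne (i1.inter i2))
    subst hBB
    obtain ⟨rfl, rfl⟩ := eq_of_mul_eq_mul h1 d1 h1' d1' e1
    obtain ⟨rfl, rfl⟩ := eq_of_mul_eq_mul (h3.trans h2) d2 (h3'.trans h2') d2' e3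
    have hE : E = E' := by
      ext b
      by_cases hb : b ∈ B
      · have := Finset.ext_iff.1 e2 b
        rw [mem_union, mem_union, or_iff_left (fun h => (mem_sdiff.1 (h5 h)).2 hb),
          or_iff_left (fun h => (mem_sdiff.1 (h5' h)).2 hb)] at this
        exact this
      · exact iff_of_false (fun h => hb (h2 h)) (fun h => hb (h2' h))
    have hE₁ : E₁ = E₁' := by
      ext b
      by_cases hb : b ∈ B
      · exact iff_of_false (fun h => (mem_sdiff.1 (h5 h)).2 hb)
          (fun h => (mem_sdiff.1 (h5' h)).2 hb)
      · have := Finset.ext_iff.1 e2 b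
        rw [mem_union, mem_union, or_iff_right (fun h => hb (h2 h)),
          or_iff_right (fun h => hb (h2' h))] at this
        exact this
    rw [hE, hE₁]
  · obtain ⟨s, E, f⟩ := x
    rw [mem_permPairs] at hx
    obtain ⟨h1, h2, h3⟩ := hx
    simp only at h1 h2 h3
    obtain ⟨B, hB, haB, hinv, hconn⟩ := exists_isConn (S := S) (s := s) (f := f)
      (fun a => ⟨apply_mem_iff h1 a, apply_mem_iff (h3.trans h2) a⟩) ha
    obtain ⟨s₀, s₁, rfl, hs0, hs1⟩ := exists_mul_of_invariant (fun a => (hinv a).1)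
    obtain ⟨f₀, f₁, rfl, hf0, hf1⟩ := exists_mul_of_invariant (fun a => (hinv a).2)
    refine ⟨⟨B, (s₀, E ∩ B, f₀), (s₁, E \ B, f₁)⟩, ?_, ?_⟩
    · simp only [mem_sigma, mem_filter, mem_powerset, mem_product, mem_connPairs, mem_permPairs]
      refine ⟨⟨hB, haB⟩, ⟨⟨hs0.trans inter_subset_right, inter_subset_right,
        hf0.trans (inter_subset_inter_right h3)⟩, ?_⟩, hs1.trans (sdiff_subset_sdiff h1 le_rfl),
        sdiff_subset_sdiff h2 le_rfl, hf1.trans (sdiff_subset_sdiff h3 le_rfl)⟩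
      exact isConn_congr
        (fun a ha => mul_apply_of_mem (disjoint_of_subset_left hs1 sdiff_disjoint) ha)
        (fun a ha => mul_apply_of_mem (disjoint_of_subset_left hf1 sdiff_disjoint) ha) hconn
    · simp only [Prod.mk.injEq, true_and, and_true]
      rw [union_comm, sdiff_union_inter]
  · obtain ⟨hB, -, h1, h2, h3, -, h4, h5, h6⟩ := aux hp
    obtain ⟨B, ⟨s, E, f⟩, ⟨s₁, E₁, f₁⟩⟩ := p
    simp only at hB h1 h2 h3 h4 h5 h6
    have hd : Disjoint B (S \ B) := disjoint_sdiff
    have hcomm : s * s₁ * (f * f₁) = s * f * (s₁ * f₁) := by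
      have : Commute s₁ f := (Perm.disjoint_iff_disjoint_support.2
        (hd.symm.mono h4 (h3.trans h2))).commute
      rw [mul_assoc, ← mul_assoc s₁, this.eq]
      group
    simp only [pairType, Prod.mk_add_mk]
    rw [← ctype_mul h1 h4 hd, ← ctype_mul h3 h6 (hd.mono h2 h5), hcomm,
      ← ctype_mul ((Perm.support_mul_le _ _).trans (union_subset h1 (h3.trans h2)))
        ((Perm.support_mul_le _ _).trans (union_subset h4 (h6.trans h5))) hd,
      union_sdiff_of_subset hB]

end Structures

/-! ### Connected pairs and connected Hurwitz numbers -/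

section Transport

variable {α : Type*} [Fintype α] [DecidableEq α] {n : ℕ} {B : Finset α}

theorem ctype_extendDomain (e : Fin n ≃ {x // x ∈ B}) (σ : Perm (Fin n)) :
    ctype B (σ.extendDomain e) = ctype univ σ := by
  have h : #B = n := by simpa using (Fintype.card_congr e).symm
  rw [ctype, ctype, Perm.cycleType_extendDomain, Perm.card_support_extend_domain, h, card_univ,
    Fintype.card_fin]

theorem support_extendDomain_subset (e : Fin n ≃ {x // x ∈ B}) (σ : Perm (Fin n)) :
    (σ.extendDomain e).support ⊆ B := fun x hx => by
  by_contra h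
  exact Perm.mem_support.1 hx (Perm.extendDomain_apply_not_subtype _ _ h)

theorem exists_extendDomain (e : Fin n ≃ {x // x ∈ B}) {f : Perm α} (hf : f.support ⊆ B) :
    ∃ σ : Perm (Fin n), σ.extendDomain e = f := by
  refine ⟨e.symm.permCongr (f.subtypePerm (apply_mem_iff hf)), Equiv.ext fun x => ?_⟩
  by_cases hx : x ∈ B
  · rw [Perm.extendDomain_apply_subtype _ _ hx]
    simp
  · rw [Perm.extendDomain_apply_not_subtype _ _ hx, apply_eq_of_notMem hf hx]

theorem extendDomain_injective (e : Fin n ≃ {x // x ∈ B}) :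
    Function.Injective fun σ : Perm (Fin n) => σ.extendDomain e :=
  Perm.extendDomainHom_injective e

theorem isInvariant_map_iff (e : Fin n ≃ {x // x ∈ B}) (s f : Perm (Fin n)) (C : Finset (Fin n)) :
    IsInvariant (C.map (e.toEmbedding.trans (Function.Embedding.subtype _))) (s.extendDomain e)
      (f.extendDomain e) ↔ IsInvariant C s f := by
  have hmem : ∀ i, (e i : α) ∈ C.map (e.toEmbedding.trans (Function.Embedding.subtype _)) ↔
      i ∈ C := fun i => mem_map' (e.toEmbedding.trans (Function.Embedding.subtype _))
  constructor
  · intro h i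
    have := h (e i)
    rwa [Perm.extendDomain_apply_image, Perm.extendDomain_apply_image, hmem, hmem, hmem] at this
  · intro h a
    by_cases ha : a ∈ B
    · obtain ⟨i, hi⟩ := e.surjective ⟨a, ha⟩
      have hi' : (e i : α) = a := congrArg Subtype.val hi
      rw [← hi', Perm.extendDomain_apply_image, Perm.extendDomain_apply_image, hmem, hmem, hmem]
      exact h i
    · rw [Perm.extendDomain_apply_not_subtype _ _ ha, Perm.extendDomain_apply_not_subtype _ _ ha]
      exact ⟨Iff.rfl, Iff.rfl⟩

theorem isConn_extendDomain_iff (e : Fin n ≃ {x // x ∈ B}) (s f : Perm (Fin n)) :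
    IsConn B (s.extendDomain e) (f.extendDomain e) ↔ IsConn univ s f := by
  set ι := e.toEmbedding.trans (Function.Embedding.subtype _) with hι
  have hB : (univ : Finset (Fin n)).map ι = B := by
    ext a
    simp only [mem_map, mem_univ, true_and]
    refine ⟨?_, fun ha => ?_⟩
    · rintro ⟨i, rfl⟩
      exact (e i).2
    · obtain ⟨i, hi⟩ := e.surjective ⟨a, ha⟩
      exact ⟨i, congrArg Subtype.val hi⟩
  constructor
  · rintro ⟨h1, h2⟩
    refine ⟨by rw [← hB, map_nonempty] at h1; exact h1, fun C _ hne hC => ?_⟩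
    have h3 := h2 (C.map ι) (hB ▸ map_subset_map.2 (subset_univ C)) (hne.map)
      ((isInvariant_map_iff e s f C).2 hC)
    exact map_injective ι (h3.trans hB.symm)
  · rintro ⟨h1, h2⟩
    refine ⟨by rw [← hB]; exact h1.map, fun C hC hne hCinv => ?_⟩
    rw [← hB, subset_map_iff] at hC
    obtain ⟨D, -, rfl⟩ := hC
    rw [h2 D (subset_univ _) (map_nonempty.1 hne) ((isInvariant_map_iff e s f D).1 hCinv), hB]

/-- Transitivity of the monodromy group, in terms of invariant subsets. -/
theorem isConn_univ_iff (s f : Perm (Fin n)) :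
    IsConn univ s f ↔
      n ≠ 0 ∧ MulAction.IsPretransitive (Subgroup.closure {s, f, (s * f)⁻¹}) (Fin n) := by
  classical
  constructor
  · rintro ⟨⟨a, -⟩, h⟩
    refine ⟨(Fin.pos a).ne', ⟨fun x y => ?_⟩⟩
    set G := Subgroup.closure {s, f, (s * f)⁻¹}
    have key : ∀ g ∈ G, ∀ b, g b ∈ MulAction.orbit G x ↔ b ∈ MulAction.orbit G x := by
      intro g hg b
      refine ⟨fun h => ?_, fun h => (MulAction.mem_orbit_of_mem_orbit (⟨g, hg⟩ : G) h :)⟩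
      have := MulAction.mem_orbit_of_mem_orbit (⟨g, hg⟩ : G)⁻¹ h
      rwa [show (⟨g, hg⟩ : G)⁻¹ • g b = b from g.symm_apply_apply b] at this
    have h1 := h (univ.filter fun b => b ∈ MulAction.orbit G x) (subset_univ _)
      ⟨x, by simp [MulAction.mem_orbit_self]⟩ (fun b => by
        simp only [mem_filter, mem_univ, true_and]
        exact ⟨key s (Subgroup.subset_closure (by simp)) b,
          key f (Subgroup.subset_closure (by simp)) b⟩)
    have h2 := mem_univ y
    rw [← h1, mem_filter] at h2
    exact MulAction.mem_orbit_iff.1 h2.2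
  · rintro ⟨hn, h⟩
    refine ⟨⟨⟨0, Nat.pos_of_ne_zero hn⟩, mem_univ _⟩, fun C _ hne hC => eq_univ_iff_forall.2 ?_⟩
    obtain ⟨a, ha⟩ := hne
    have key : ∀ g ∈ Subgroup.closure {s, f, (s * f)⁻¹}, ∀ b, g b ∈ C ↔ b ∈ C := by
      intro g hg
      induction hg using Subgroup.closure_induction with
      | mem g hg =>
        rcases hg with rfl | rfl | rfl
        · exact fun b => (hC b).1
        · exact fun b => (hC b).2
        · intro b
          rw [← (hC _).2, ← (hC _).1, ← Perm.mul_apply, ← Perm.mul_apply, mul_inv_cancel,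
            Perm.one_apply]
      | one => exact fun b => Iff.rfl
      | mul g g' _ _ h1 h2 => exact fun b => (h1 _).trans (h2 b)
      | inv g _ h1 => exact fun b => by rw [← h1, ← Perm.mul_apply, mul_inv_cancel, Perm.one_apply]
    intro b
    obtain ⟨⟨g, hg⟩, hgb⟩ := h.exists_smul_eq a b
    have : g a = b := hgb
    rw [← this, key g hg]
    exact ha

/-- The connected Hurwitz number of the triple `t`, or zero if the degrees do not match. By
`card_connPairs` it is the number of connected pairs of type `t` on `n` points, divided by `n!`. -/
def connCoeff (t : Triple) : ℂ :=
  (if size t.2.2 = size t.1 then 1 else 0) * connHurwitz (size t.1) t.1 t.2.1 t.2.2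

theorem shift_size (Γ : Ptn) : shift (size Γ) Γ = Γ := by
  simp [shift]

theorem shiftBinom_size (Γ : Ptn) : shiftBinom (size Γ) Γ = 1 := by
  simp [shiftBinom]

open Classical in
theorem card_triples (B : Finset α) (Γ Δ Θ : Ptn) :
    Nat.card {s : Perm (Fin #B) × Perm (Fin #B) × Perm (Fin #B) //
      HasType s.1 Γ ∧ HasType s.2.1 Δ ∧ HasType s.2.2 Θ ∧
      s.1 * s.2.1 * s.2.2 = 1 ∧ #B ≠ 0 ∧
      MulAction.IsPretransitive (Subgroup.closure {s.1, s.2.1, s.2.2}) (Fin #B)} =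
    #{p : Perm α × Perm α | (p.1.support ⊆ B ∧ p.2.support ⊆ B ∧ IsConn B p.1 p.2 ∧
      ctype B p.1 = Γ ∧ ctype B (p.1 * p.2) = Θ) ∧ ctype B p.2 = Δ} := by
  set e : Fin #B ≃ {x // x ∈ B} := B.equivFin.symm
  rw [← Fintype.card_coe (Finset.filter _ _), ← Nat.card_eq_fintype_card]
  refine Nat.card_eq_of_bijective (fun s => ⟨(s.1.1.extendDomain e, s.1.2.1.extendDomain e), ?_⟩)
    ⟨fun s s' h => ?_, fun p => ?_⟩
  · obtain ⟨⟨s, f, r⟩, h1, h2, h3, h4, h5, h6⟩ := s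
    simp only at h1 h2 h3 h4 h5 h6
    obtain rfl : r = (s * f)⁻¹ := (inv_eq_of_mul_eq_one_right h4).symm
    simp only [mem_filter, mem_univ, true_and]
    rw [isConn_extendDomain_iff, isConn_univ_iff, Perm.extendDomain_mul, ctype_extendDomain,
      ctype_extendDomain, ctype_extendDomain, ← hasType_iff, ← hasType_iff, ← hasType_iff]
    refine ⟨⟨support_extendDomain_subset e s, support_extendDomain_subset e f, ⟨h5, h6⟩, h1, ?_⟩,
      h2⟩
    rwa [hasType_iff, ctype_inv, ← hasType_iff] at h3
  · obtain ⟨⟨s, f, r⟩, h1, h2, h3, h4, h5, h6⟩ := s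
    obtain ⟨⟨s', f', r'⟩, h1', h2', h3', h4', h5', h6'⟩ := s'
    have hs := extendDomain_injective e (congrArg (fun p => p.1.1) h)
    have hf := extendDomain_injective e (congrArg (fun p => p.1.2) h)
    simp only at hs hf h4 h4'
    subst hs hf
    have : r = r' := mul_left_cancel (h4.trans h4'.symm)
    subst this
    rfl
  · obtain ⟨⟨s, f⟩, hp⟩ := p
    simp only [mem_filter, mem_univ, true_and] at hp
    obtain ⟨⟨h1, h2, h3, h4, h5⟩, h6⟩ := hp
    obtain ⟨s, rfl⟩ := exists_extendDomain e h1
    obtain ⟨f, rfl⟩ := exists_extendDomain e h2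
    rw [isConn_extendDomain_iff, isConn_univ_iff] at h3
    rw [ctype_extendDomain, ← hasType_iff] at h4 h6
    rw [Perm.extendDomain_mul, ctype_extendDomain, ← ctype_inv, ← hasType_iff] at h5
    exact ⟨⟨(s, f, (s * f)⁻¹), h4, h6, h5, mul_inv_cancel _, h3.1, h3.2⟩, rfl⟩

open Classical in
/-- Forgetting the set `E` of a partial permutation `(E, f)` of type `Δ`. -/
theorem card_connPairs_eq_mul (B : Finset α) (t : Triple) :
    #{y ∈ connPairs B | pairType B y = t} = shiftBinom #B t.2.1 *
      #{p : Perm α × Perm α | (p.1.support ⊆ B ∧ p.2.support ⊆ B ∧ IsConn B p.1 p.2 ∧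
        ctype B p.1 = t.1 ∧ ctype B (p.1 * p.2) = t.2.2) ∧ ctype B p.2 = shift #B t.2.1} := by
  rw [card_eq_sum_card_fiberwise (f := fun y => (y.1, y.2.2))
    (t := {p : Perm α × Perm α | p.1.support ⊆ B ∧ p.2.support ⊆ B ∧ IsConn B p.1 p.2 ∧
      ctype B p.1 = t.1 ∧ ctype B (p.1 * p.2) = t.2.2})]
  · rw [← filter_filter (fun p : Perm α × Perm α => p.1.support ⊆ B ∧ p.2.support ⊆ B ∧
      IsConn B p.1 p.2 ∧ ctype B p.1 = t.1 ∧ ctype B (p.1 * p.2) = t.2.2)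
      (fun p : Perm α × Perm α => ctype B p.2 = shift #B t.2.1), mul_comm,
      ← smul_eq_mul, ← sum_const,
      sum_filter (fun p : Perm α × Perm α => ctype B p.2 = shift #B t.2.1)]
    refine sum_congr rfl fun p hp => ?_
    simp only [mem_filter, mem_univ, true_and] at hp
    rw [← card_support_superset hp.2.1]
    symm
    refine card_bij (fun E _ => (p.1, E, p.2)) (fun E hE => ?_) (fun E _ E' _ h => ?_)
      (fun y hy => ?_)
    · simp only [mem_filter, mem_univ, true_and, mem_connPairs, mem_permPairs] at hE ⊢
      exact ⟨⟨⟨⟨hp.1, hE.1, hE.2.1⟩, hp.2.2.1⟩, Prod.ext hp.2.2.2.1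
        (Prod.ext hE.2.2 hp.2.2.2.2)⟩, trivial⟩
    · exact congrArg (fun y => y.2.1) h
    · obtain ⟨s, E, f⟩ := y
      simp only [mem_filter, mem_univ, true_and, mem_connPairs, mem_permPairs] at hy ⊢
      obtain ⟨⟨⟨⟨h1, h2, h3⟩, h4⟩, rfl⟩, rfl⟩ := hy
      exact ⟨E, ⟨h2, h3, rfl⟩, rfl⟩
  · intro y hy
    rw [mem_coe, mem_filter, mem_connPairs, mem_permPairs] at hy
    rw [mem_coe, mem_filter]
    obtain ⟨⟨⟨h1, h2, h3⟩, h4⟩, rfl⟩ := hy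
    exact ⟨mem_univ _, h1, h3.trans h2, h4, rfl, rfl⟩

open Classical in
/-- The connected pairs on `B` are counted by the connected Hurwitz numbers. -/
theorem card_connPairs (B : Finset α) (t : Triple) :
    (#{y ∈ connPairs B | pairType B y = t} : ℂ) =
      if size t.1 = #B then ((#B)! : ℂ) * connCoeff t else 0 := by
  by_cases h : size t.1 = #B ∧ size t.2.2 = #B
  · rw [if_pos h.1, card_connPairs_eq_mul, connCoeff, if_pos (h.2.trans h.1.symm), one_mul,
      connHurwitz, shiftBinom_size, show shiftBinom (size t.1) t.2.2 = 1 by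
        rw [h.1, ← h.2, shiftBinom_size], shift_size,
      show shift (size t.1) t.2.2 = t.2.2 by rw [h.1, ← h.2, shift_size], h.1, card_triples,
      mul_div_cancel₀ _ (Nat.cast_ne_zero.2 (Nat.factorial_ne_zero _))]
    push_cast
    ring
  · have h0 : #{y ∈ connPairs B | pairType B y = t} = 0 := by
      rw [card_eq_zero, filter_eq_empty_iff]
      rintro y hy rfl
      rw [mem_connPairs, mem_permPairs] at hy
      obtain ⟨⟨h1, h2, h3⟩, -⟩ := hy
      exact h ⟨size_ctype h1, size_ctype ((Perm.support_mul_le _ _).trans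
        (union_subset h1 (h3.trans h2)))⟩
    rw [h0, Nat.cast_zero]
    split_ifs with h1
    · rw [connCoeff, if_neg (fun h2 => h ⟨h1, h2.trans h1⟩), zero_mul, mul_zero]
    · rfl

end Transport

/-! ### The exponential formula -/

section Exponential

theorem size_zero : size 0 = 0 := rfl

theorem size_eq_zero_iff {Γ : Ptn} : size Γ = 0 ↔ Γ = 0 := by
  refine ⟨fun h => ?_, fun h => h ▸ rfl⟩
  have := card_le_size Γ
  rw [h] at this
  exact Multiset.card_eq_zero.1 (Nat.le_zero.1 this)

theorem srcSum_cons (t : Triple) (T : Multiset Triple) : srcSum (t ::ₘ T) = t.1 + srcSum T := by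
  simp [srcSum]

theorem sum_triples (T : Multiset Triple) : T.sum = (srcSum T, midSum T, tgtSum T) := by
  induction T using Multiset.induction_on with
  | empty => rfl
  | cons t T ih =>
    rw [Multiset.sum_cons, ih, srcSum, midSum, tgtSum, srcSum, midSum, tgtSum]
    simp only [Multiset.map_cons, Multiset.sum_cons]
    rfl

/-- The triples of types of pairs `(s, (E, f))` on a nonempty set of `n` points satisfy these
constraints. -/
def IsAdm (t : Triple) : Prop :=
  1 ≤ size t.1 ∧ size t.2.1 ≤ size t.1 ∧ size t.2.2 = size t.1

theorem admSeries_finite (n : ℕ) :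
    {T : Multiset Triple | size (srcSum T) = n ∧ ∀ t ∈ T, IsAdm t}.Finite := by
  have hS := (size_finite n).prod ((size_finite n).prod (size_finite n))
  refine (multiset_finite hS n).subset ?_
  rintro T ⟨rfl, hT⟩
  refine ⟨fun t ht => ?_, ?_⟩
  · have h1 : size t.1 ≤ size (srcSum T) := size_mono
      (Multiset.single_le_sum (fun _ _ => bot_le) _ (Multiset.mem_map_of_mem _ ht))
    obtain ⟨-, h2, h3⟩ := hT t ht
    exact ⟨h1, h2.trans h1, h3.trans_le h1⟩
  · clear hS
    induction T using Multiset.induction_on with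
    | empty => simp
    | cons t T ih =>
      have h1 := ih fun s hs => hT s (Multiset.mem_cons_of_mem hs)
      have h2 := (hT t (Multiset.mem_cons_self t T)).1
      rw [Multiset.card_cons, srcSum_cons, size_add]
      omega

/-- The multisets of admissible triples of total degree `n`. -/
def admSeries (n : ℕ) : Finset (Multiset Triple) := (admSeries_finite n).toFinset

theorem mem_admSeries {n : ℕ} {T : Multiset Triple} :
    T ∈ admSeries n ↔ size (srcSum T) = n ∧ ∀ t ∈ T, IsAdm t := by
  simp [admSeries]

theorem admTriples_finite (n : ℕ) : {t : Triple | size t.1 = n ∧ IsAdm t}.Finite := by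
  refine ((size_finite n).prod ((size_finite n).prod (size_finite n))).subset ?_
  rintro t ⟨h, -, h2, h3⟩
  exact ⟨h.le, h2.trans h.le, h3.trans_le h.le⟩

/-- The admissible triples of degree `n`. -/
def admTriples (n : ℕ) : Finset Triple := (admTriples_finite n).toFinset

theorem mem_admTriples {n : ℕ} {t : Triple} : t ∈ admTriples n ↔ size t.1 = n ∧ IsAdm t := by
  simp [admTriples]

/-- The weight `∏ connCoeff t / |Aut|` of a multiset of triples in the exponential formula. -/
def expCoeff (T : Multiset Triple) : ℂ := (T.map connCoeff).prod / (autCard T : ℂ)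

open Classical in
theorem autCard_cons (t : Triple) (T : Multiset Triple) :
    autCard (t ::ₘ T) = (T.count t + 1) * autCard T := by
  have h1 : t ∈ (t ::ₘ T).toFinset := by simp
  have h2 : autCard T = ∏ i ∈ (t ::ₘ T).toFinset, (T.count i)! :=
    prod_subset (by simp) fun i _ hi => by
      rw [Multiset.count_eq_zero_of_notMem (fun h => hi (Multiset.mem_toFinset.2 h)),
        Nat.factorial_zero]
  rw [h2, autCard, ← mul_prod_erase _ _ h1, ← mul_prod_erase _ _ h1, ← mul_assoc,
    Multiset.count_cons_self, Nat.factorial_succ]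
  congr 1
  refine prod_congr rfl fun j hj => ?_
  rw [Multiset.count_cons_of_ne (ne_of_mem_erase hj)]

theorem autCard_pos (T : Multiset Triple) : 0 < autCard T :=
  prod_pos fun _ _ => Nat.factorial_pos _

open Classical in
theorem count_mul_expCoeff_cons (t : Triple) (T : Multiset Triple) :
    ((t ::ₘ T).count t : ℂ) * expCoeff (t ::ₘ T) = connCoeff t * expCoeff T := by
  have h1 : (autCard T : ℂ) ≠ 0 := Nat.cast_ne_zero.2 (autCard_pos T).ne'
  have h2 : (T.count t : ℂ) + 1 ≠ 0 := Nat.cast_add_one_ne_zero _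
  rw [expCoeff, expCoeff, autCard_cons, Multiset.map_cons, Multiset.prod_cons,
    Multiset.count_cons_self]
  push_cast
  field_simp

variable {M : Type*} [AddCommGroup M] [Module ℂ M]

/-- The Euler-type recursion for the sum over multisets: marking one triple, weighted by its
degree. -/
theorem smul_sum_admSeries (F : Triple → M) (n : ℕ) :
    (n : ℂ) • ∑ T ∈ admSeries n, expCoeff T • F T.sum =
      ∑ k ∈ Icc 1 n, ∑ t ∈ admTriples k, ∑ T ∈ admSeries (n - k),
        ((k : ℂ) * (connCoeff t * expCoeff T)) • F (t + T.sum) := by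
  classical
  have h1 : ∀ T ∈ admSeries n, (n : ℂ) • expCoeff T • F T.sum =
      ∑ t ∈ T.toFinset, ((size t.1 : ℂ) * ((T.count t : ℂ) * expCoeff T)) • F T.sum := by
    intro T hT
    have hn : n = ∑ t ∈ T.toFinset, T.count t * size t.1 := by
      rw [← (mem_admSeries.1 hT).1]
      have e : ∀ T : Multiset Triple, size (srcSum T) = (T.map fun t => size t.1).sum := by
        intro T
        induction T using Multiset.induction_on with
        | empty => rfl
        | cons t T ih => rw [srcSum_cons, size_add, Multiset.map_cons, Multiset.sum_cons, ih]
      rw [e, sum_multiset_map_count]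
      simp
    rw [← sum_smul, smul_smul]
    congr 1
    conv_lhs => rw [hn]
    push_cast
    rw [sum_mul]
    exact sum_congr rfl fun _ _ => by ring
  rw [smul_sum, sum_congr rfl h1]
  simp_rw [← sum_product', sum_sigma']
  refine sum_bij' (i := fun p _ => ⟨size p.2.1, (p.2, p.1.erase p.2)⟩)
    (j := fun q _ => ⟨q.2.1 ::ₘ q.2.2, q.2.1⟩) ?_ ?_ ?_ ?_ ?_
  · rintro ⟨T, t⟩ hp
    rw [mem_sigma, Multiset.mem_toFinset, mem_admSeries] at hp
    obtain ⟨⟨h1, h2⟩, h3⟩ := hp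
    simp only at h1 h2 h3
    have h4 : size (srcSum T) = size t.1 + size (srcSum (T.erase t)) := by
      conv_lhs => rw [← Multiset.cons_erase h3, srcSum_cons, size_add]
    rw [mem_sigma, mem_product, mem_admTriples, mem_admSeries, mem_Icc]
    refine ⟨⟨(h2 t h3).1, ?_⟩, ⟨rfl, h2 t h3⟩, ?_, fun s hs => h2 s (Multiset.mem_of_mem_erase hs)⟩
    · change size t.1 ≤ n
      omega
    · change size (srcSum (T.erase t)) = n - size t.1
      omega
  · rintro ⟨k, t, T⟩ hq
    rw [mem_sigma, mem_product, mem_admTriples, mem_admSeries, mem_Icc] at hq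
    obtain ⟨⟨h1, h2⟩, ⟨h3, h4⟩, h5, h6⟩ := hq
    simp only at h1 h2 h3 h4 h5 h6
    rw [mem_sigma, Multiset.mem_toFinset, mem_admSeries]
    refine ⟨⟨?_, fun s hs => ?_⟩, Multiset.mem_cons_self t T⟩
    · change size (srcSum (t ::ₘ T)) = n
      rw [srcSum_cons, size_add]
      omega
    · rcases Multiset.mem_cons.1 hs with rfl | hs
      exacts [h4, h6 s hs]
  · rintro ⟨T, t⟩ hp
    rw [mem_sigma, Multiset.mem_toFinset] at hp
    simp only [Multiset.cons_erase hp.2]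
  · rintro ⟨k, t, T⟩ hq
    rw [mem_sigma, mem_product, mem_admTriples] at hq
    obtain ⟨-, ⟨h3, -⟩, -⟩ := hq
    simp only at h3
    subst h3
    simp
  · rintro ⟨T, t⟩ hp
    rw [mem_sigma, Multiset.mem_toFinset] at hp
    have := count_mul_expCoeff_cons t (T.erase t)
    rw [Multiset.cons_erase hp.2] at this
    simp only
    rw [this, ← Multiset.sum_cons, Multiset.cons_erase hp.2]

variable {α : Type*} [Fintype α] [DecidableEq α]

theorem isAdm_pairType {B : Finset α} {y : Perm α × Finset α × Perm α} (hy : y ∈ connPairs B) :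
    size (pairType B y).1 = #B ∧ IsAdm (pairType B y) := by
  rw [mem_connPairs, mem_permPairs] at hy
  obtain ⟨⟨h1, h2, h3⟩, h4⟩ := hy
  have e1 : size (pairType B y).1 = #B := size_ctype h1
  have e2 : size (pairType B y).2.1 = #y.2.1 := size_ctype h3
  have e3 : size (pairType B y).2.2 = #B := size_ctype ((Perm.support_mul_le _ _).trans
      (union_subset h1 (h3.trans h2)))
  exact ⟨e1, by rw [e1]; exact h4.1.card_pos, by
    rw [e1, e2]; exact card_le_card h2, e3.trans e1.symm⟩

theorem isAdm_of_connCoeff_ne_zero {t : Triple} (h : connCoeff t ≠ 0) : IsAdm t := by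
  classical
  have h1 := card_connPairs (univ : Finset (Fin (size t.1))) t
  rw [if_pos (by simp)] at h1
  have h2 : #{y ∈ connPairs (univ : Finset (Fin (size t.1))) | pairType univ y = t} ≠ 0 := by
    intro h0
    rw [h0, Nat.cast_zero, zero_eq_mul] at h1
    exact h1.elim (Nat.cast_ne_zero.2 (Nat.factorial_ne_zero _)) h
  obtain ⟨y, hy⟩ := card_ne_zero.1 h2
  rw [mem_filter] at hy
  exact hy.2 ▸ (isAdm_pairType hy.1).2

theorem sum_connPairs (F : Triple → M) (B : Finset α) :
    ∑ y ∈ connPairs B, F (pairType B y) =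
      ∑ t ∈ admTriples #B, (((#B)! : ℂ) * connCoeff t) • F t := by
  classical
  rw [← sum_fiberwise_of_maps_to (s := connPairs B) (t := admTriples #B) (g := pairType B)]
  · refine sum_congr rfl fun t ht => ?_
    have h1 := card_connPairs B t
    rw [if_pos (mem_admTriples.1 ht).1] at h1
    rw [← h1, sum_congr rfl (g := fun _ => F t) (fun y hy => by rw [(mem_filter.1 hy).2]),
      sum_const, Nat.cast_smul_eq_nsmul]
  · exact fun y hy => mem_admTriples.2 (isAdm_pairType hy)

/-- The exponential formula: a pair `(s, (E, f))` on `S` is the disjoint union of its restrictions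
to the orbits of `⟨s, f⟩`. -/
theorem sum_permPairs_eq (F : Triple → M) (S : Finset α) :
    ∑ x ∈ permPairs S, F (pairType S x) =
      ((#S)! : ℂ) • ∑ T ∈ admSeries #S, expCoeff T • F T.sum := by
  classical
  induction S using Finset.strongInduction generalizing F with
  | H S ih =>
  rcases S.eq_empty_or_nonempty with rfl | ⟨a, ha⟩
  · have h1 : permPairs (∅ : Finset α) = {(1, ∅, 1)} := by
      ext ⟨s, E, f⟩
      simp only [mem_permPairs, subset_empty, Perm.support_eq_empty_iff, mem_singleton,
        Prod.mk.injEq]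
      constructor
      · rintro ⟨rfl, rfl, h⟩
        exact ⟨rfl, rfl, Perm.support_eq_empty_iff.1 (subset_empty.1 h)⟩
      · rintro ⟨rfl, rfl, rfl⟩
        simp
    have h2 : admSeries 0 = {0} := by
      ext T
      rw [mem_admSeries, mem_singleton]
      constructor
      · rintro ⟨h, hT⟩
        refine Multiset.eq_zero_of_forall_notMem fun t ht => ?_
        have h1 : size t.1 ≤ size (srcSum T) := size_mono
          (Multiset.single_le_sum (fun _ _ => bot_le) _ (Multiset.mem_map_of_mem _ ht))
        have := (hT t ht).1
        omega
      · rintro rfl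
        exact ⟨rfl, by simp⟩
    have h3 : expCoeff 0 = 1 := by simp [expCoeff, autCard]
    rw [h1, sum_singleton, card_empty, h2, sum_singleton, h3]
    have h4 : pairType (∅ : Finset α) (1, ∅, 1) = (0 : Multiset Triple).sum := by
      simp only [pairType, mul_one, ctype_one]
      rfl
    rw [h4]
    simp
  · have hn : 1 ≤ #S := card_pos.2 ⟨a, ha⟩
    -- the contribution of the orbit `B` of `a` depends only on the size of `B`
    let G : ℕ → M := fun k => ∑ t ∈ admTriples k, ∑ T ∈ admSeries (#S - k),
      (((k ! : ℂ) * (#S - k)!) * (connCoeff t * expCoeff T)) • F (t + T.sum)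
    have hB : ∀ B ∈ S.powerset.filter (a ∈ ·),
        ∑ y ∈ connPairs B, ∑ z ∈ permPairs (S \ B), F (pairType B y + pairType (S \ B) z) =
          G #B := by
      intro B hB
      rw [mem_filter, mem_powerset] at hB
      have hlt : S \ B ⊂ S := sdiff_ssubset hB.1 ⟨a, hB.2⟩
      simp_rw [fun y => ih (S \ B) hlt (fun t => F (pairType B y + t))]
      rw [sum_connPairs (fun t => ((#(S \ B))! : ℂ) • ∑ T ∈ admSeries #(S \ B),
        expCoeff T • F (t + T.sum)), card_sdiff_of_subset hB.1]
      refine sum_congr rfl fun t _ => ?_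
      rw [smul_sum, smul_sum]
      refine sum_congr rfl fun T _ => ?_
      rw [smul_smul, smul_smul]
      congr 1
      ring
    have hsub : ∑ B ∈ S.powerset with a ∈ B, G #B =
        ∑ k ∈ Icc 1 #S, ((#S - 1).choose (k - 1)) • G k := by
      have h1 : ∑ B ∈ S.powerset with a ∈ B, G #B =
          ∑ B ∈ (S.erase a).powerset, G (#B + 1) := by
        refine sum_bij' (fun B _ => B.erase a) (fun B _ => insert a B) ?_ ?_ ?_ ?_ ?_
        · intro B hB
          rw [mem_filter, mem_powerset] at hB
          exact mem_powerset.2 (erase_subset_erase _ hB.1)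
        · intro B hB
          rw [mem_powerset] at hB
          exact mem_filter.2 ⟨mem_powerset.2 (insert_subset ha (hB.trans (erase_subset _ _))),
            mem_insert_self _ _⟩
        · intro B hB
          exact insert_erase (mem_filter.1 hB).2
        · intro B hB
          exact erase_insert fun h => (mem_erase.1 (mem_powerset.1 hB h)).1 rfl
        · intro B hB
          rw [card_erase_add_one (mem_filter.1 hB).2]
      rw [h1, sum_powerset_apply_card (fun k => G (k + 1)), card_erase_of_mem ha,
        Nat.sub_add_cancel hn, range_eq_Ico]
      have h2 := sum_Ico_add' (fun k => ((#S - 1).choose (k - 1)) • G k) 0 #S 1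
      simp only [Nat.add_sub_cancel, zero_add] at h2
      rw [h2]
      rfl
    rw [sum_permPairs F ha, sum_congr rfl hB, hsub]
    have hfac : ((#S)! : ℂ) = ((#S - 1)! : ℂ) * (#S : ℂ) := by
      rw [← Nat.mul_factorial_pred (by omega : #S ≠ 0)]
      push_cast
      ring
    rw [hfac, mul_smul, smul_sum_admSeries, smul_sum]
    refine sum_congr rfl fun k hk => ?_
    rw [mem_Icc] at hk
    have hch : (((#S - 1).choose (k - 1) : ℕ) : ℂ) * ((k ! : ℂ) * (#S - k)!) =
        ((#S - 1)! : ℂ) * k := by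
      have e1 := Nat.choose_mul_factorial_mul_factorial (show k - 1 ≤ #S - 1 by omega)
      rw [show #S - 1 - (k - 1) = #S - k by omega] at e1
      rw [← Nat.mul_factorial_pred (by omega : k ≠ 0), ← e1]
      push_cast
      ring
    rw [← Nat.cast_smul_eq_nsmul ℂ, smul_sum, smul_sum]
    refine sum_congr rfl fun t _ => ?_
    rw [smul_sum, smul_sum]
    refine sum_congr rfl fun T _ => ?_
    rw [smul_smul, smul_smul, ← mul_assoc, hch, mul_assoc]

end Exponential

/-! ### Adding idle cycles to a series of triples -/

section Trivial

variable {α : Type*} [Fintype α] [DecidableEq α]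

/-- The cyclic group generated by `s` is transitive exactly if `s` is a full cycle. -/
theorem isConn_one_iff (s : Perm α) :
    IsConn univ s 1 ↔ ∃ i : ℕ+, ctype univ s = {i} := by
  constructor
  · rintro ⟨⟨a, -⟩, h⟩
    by_cases hs : s = 1
    · subst hs
      have h1 := h {a} (subset_univ _) ⟨a, mem_singleton_self a⟩ (fun b => by simp)
      exact ⟨1, by rw [ctype_one, ← h1]; rfl⟩
    · obtain ⟨c, hc⟩ : s.cycleFactorsFinset.Nonempty := by
        rw [nonempty_iff_ne_empty, Ne, Perm.cycleFactorsFinset_eq_empty_iff]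
        exact hs
      have hc' := Perm.mem_cycleFactorsFinset_iff.1 hc
      have h1 := h c.support (subset_univ _) hc'.1.nonempty_support (fun b =>
        ⟨Perm.mem_cycleFactorsFinset_support hc b, by simp⟩)
      have h2 : c = s := Equiv.ext fun a => hc'.2 a (h1 ▸ mem_univ a)
      subst h2
      refine ⟨(#c.support).toPNat', ?_⟩
      rw [ctype, hc'.1.cycleType, h1]
      simp
  · rintro ⟨i, hi⟩
    have h1 := congrArg (Multiset.map (fun i : ℕ+ => (i : ℕ))) hi
    rw [map_coe_ctype, Multiset.map_singleton] at h1
    have h2 := congrArg Multiset.card h1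
    rw [Multiset.card_add, Multiset.card_replicate, Multiset.card_singleton] at h2
    have hcard : 1 ≤ #(univ : Finset α) := by
      have := size_ctype_univ s
      rw [hi] at this
      simp only [size, Multiset.map_singleton, Multiset.sum_singleton] at this
      rw [card_univ, ← this]
      exact i.pos
    refine ⟨card_pos.1 hcard, fun C _ hne hC => ?_⟩
    by_cases hs : s = 1
    · subst hs
      rw [Perm.cycleType_one, Multiset.card_zero, Perm.support_one, card_empty] at h2
      refine eq_univ_of_card C (le_antisymm (card_le_univ C) ?_)
      rw [← card_univ]
      have := hne.card_pos
      omega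
    · have h3 : 0 < s.cycleType.card :=
        Multiset.card_pos.2 fun h => hs (Perm.cycleType_eq_zero.1 h)
      have hcyc : s.IsCycle := Perm.card_cycleType_eq_one.1 (by omega)
      have hsupp : s.support = univ :=
        eq_univ_of_card _ (le_antisymm (card_le_univ _) (by rw [← card_univ]; omega))
      obtain ⟨a, ha⟩ := hne
      refine eq_univ_iff_forall.2 fun b => ?_
      obtain ⟨k, -, rfl⟩ := (hcyc.sameCycle (Perm.mem_support.1 (hsupp ▸ mem_univ a))
        (Perm.mem_support.1 (hsupp ▸ mem_univ b))).exists_pow_eq'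
      induction k with
      | zero => exact ha
      | succ k ih =>
        rw [pow_succ', Perm.mul_apply, (hC _).1]
        exact ih

/-- The triple of a full cycle of length `i` together with the empty partial permutation. -/
def idTriple (i : ℕ+) : Triple := ({i}, 0, {i})

theorem size_singleton (i : ℕ+) : size {i} = i := by simp [size]

open Classical in
theorem card_connPairs_zero (Γ Θ : Ptn) :
    #{y ∈ connPairs (univ : Finset α) | pairType univ y = (Γ, 0, Θ)} =
      #{s : Perm α | ctype univ s = Γ ∧ Γ = Θ ∧ ∃ i : ℕ+, ctype univ s = {i}} := by
  symm
  refine card_bij (fun s _ => (s, ∅, 1)) (fun s hs => ?_) (fun s _ s' _ h => congrArg Prod.fst h)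
    (fun y hy => ?_)
  · rw [mem_filter] at hs
    obtain ⟨-, rfl, rfl, hs⟩ := hs
    rw [mem_filter, mem_connPairs, mem_permPairs]
    refine ⟨⟨⟨subset_univ _, subset_univ _, by simp⟩, (isConn_one_iff s).2 hs⟩, ?_⟩
    rw [pairType, mul_one, ctype_one]
    rfl
  · obtain ⟨s, E, f⟩ := y
    rw [mem_filter, mem_connPairs, mem_permPairs, pairType] at hy
    obtain ⟨⟨⟨-, -, h1⟩, h2⟩, h3⟩ := hy
    simp only [Prod.mk.injEq] at h1 h2 h3
    obtain ⟨rfl, h4, rfl⟩ := h3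
    have h5 := size_ctype h1
    rw [h4, size_zero, eq_comm, card_eq_zero] at h5
    subst h5
    obtain rfl : f = 1 := Perm.support_eq_empty_iff.1 (subset_empty.1 h1)
    exact ⟨s, mem_filter.2 ⟨mem_univ _, rfl, by rw [mul_one], (isConn_one_iff s).1 h2⟩, rfl⟩

theorem connCoeff_idTriple (i : ℕ+) : connCoeff (idTriple i) = 1 / (i : ℂ) := by
  classical
  have h1 := card_connPairs (univ : Finset (Fin (size {i}))) (idTriple i)
  rw [if_pos (by simp [idTriple]), idTriple, card_connPairs_zero] at h1
  have h2 := card_class_mul (α := Fin (size {i})) (Γ := {i}) (by simp)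
  have h3 : (Finset.univ.filter fun s : Perm (Fin (size {i})) => ctype univ s = {i} ∧
      ({i} : Ptn) = {i} ∧ ∃ j : ℕ+, ctype univ s = {j}) =
      Finset.univ.filter fun s : Perm (Fin (size {i})) => ctype univ s = {i} :=
    filter_congr fun s _ => ⟨fun h => h.1, fun h => ⟨h, rfl, i, h⟩⟩
  rw [h3] at h1
  have h4 : normProd {i} * mfac {i} = i := by
    simp [normProd, mfac]
  rw [h4] at h2
  have h5 := congrArg (Nat.cast : ℕ → ℂ) h2
  rw [Nat.cast_mul, h1, card_univ] at h5
  have h6 : ((Fintype.card (Fin (size {i})))! : ℂ) ≠ 0 :=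
    Nat.cast_ne_zero.2 (Nat.factorial_ne_zero _)
  have h7 : ((i : ℕ) : ℂ) ≠ 0 := Nat.cast_ne_zero.2 i.pos.ne'
  rw [idTriple, eq_div_iff h7]
  exact mul_left_cancel₀ h6 (by rw [← mul_assoc, h5, mul_one])

theorem eq_idTriple_of_connCoeff_ne_zero {t : Triple} (h : connCoeff t ≠ 0)
    (ht : t.2.1 = 0) : ∃ i, t = idTriple i := by
  classical
  obtain ⟨Γ, Δ, Θ⟩ := t
  simp only at ht
  subst ht
  have h1 := card_connPairs (univ : Finset (Fin (size Γ))) (Γ, 0, Θ)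
  rw [if_pos (by simp), card_connPairs_zero] at h1
  have h2 : #{s : Perm (Fin (size Γ)) | ctype univ s = Γ ∧ Γ = Θ ∧ ∃ i : ℕ+, ctype univ s = {i}}
      ≠ 0 := by
    intro h0
    rw [h0, Nat.cast_zero, zero_eq_mul] at h1
    exact h1.elim (Nat.cast_ne_zero.2 (Nat.factorial_ne_zero _)) h
  obtain ⟨s, hs⟩ := card_ne_zero.1 h2
  rw [mem_filter] at hs
  obtain ⟨-, h3, rfl, i, hi⟩ := hs
  exact ⟨i, by rw [idTriple, ← hi, h3]⟩

end Trivial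

section Series

theorem srcSum_add (T T' : Multiset Triple) : srcSum (T + T') = srcSum T + srcSum T' := by
  simp [srcSum]

theorem midSum_add (T T' : Multiset Triple) : midSum (T + T') = midSum T + midSum T' := by
  simp [midSum]

theorem tgtSum_add (T T' : Multiset Triple) : tgtSum (T + T') = tgtSum T + tgtSum T' := by
  simp [tgtSum]

theorem srcSum_idTriple (Ξ : Ptn) : srcSum (Ξ.map idTriple) = Ξ := by
  rw [srcSum, Multiset.map_map]
  exact Multiset.sum_map_singleton Ξ

theorem midSum_idTriple (Ξ : Ptn) : midSum (Ξ.map idTriple) = 0 := by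
  rw [midSum, Multiset.map_map]
  exact Multiset.sum_eq_zero fun Δ hΔ => by
    obtain ⟨i, -, rfl⟩ := Multiset.mem_map.1 hΔ
    rfl

theorem tgtSum_idTriple (Ξ : Ptn) : tgtSum (Ξ.map idTriple) = Ξ := by
  rw [tgtSum, Multiset.map_map]
  exact Multiset.sum_map_singleton Ξ

theorem normProd_add (Γ Δ : Ptn) : normProd (Γ + Δ) = normProd Γ * normProd Δ := by
  simp [normProd]

theorem normProd_pos (Γ : Ptn) : 0 < normProd Γ := by
  refine Multiset.prod_pos fun i hi => ?_
  obtain ⟨j, -, rfl⟩ := Multiset.mem_map.1 hi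
  exact j.pos

theorem idTriple_injective : Function.Injective idTriple := fun _ _ h =>
  Multiset.singleton_inj.1 (congrArg Prod.fst h)

theorem autCard_add_idTriple {T : Multiset Triple} (hT : ∀ t ∈ T, 1 ≤ size t.2.1) (Ξ : Ptn) :
    autCard (T + Ξ.map idTriple) = autCard T * mfac Ξ := by
  classical
  induction Ξ using Multiset.induction_on with
  | empty => simp [mfac]
  | cons i Ξ ih =>
    have h : idTriple i ∉ T := fun h => absurd (hT _ h) (by simp [idTriple, size_zero])
    rw [Multiset.map_cons, Multiset.add_cons, autCard_cons, ih, mfac_cons, Multiset.count_add,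
      Multiset.count_eq_zero_of_notMem h, Multiset.count_map_eq_count' _ _ idTriple_injective]
    ring

theorem seriesCoeff_eq (T : Multiset Triple) :
    seriesCoeff T = normProd (srcSum T) * (T.map connCoeff).prod / autCard T := by
  rw [seriesCoeff]
  congr 1
  induction T using Multiset.induction_on with
  | empty => simp [srcSum, normProd]
  | cons t T ih =>
    rw [Multiset.map_cons, Multiset.prod_cons, ih, srcSum_cons, normProd_add, Multiset.map_cons,
      Multiset.prod_cons, connCoeff]
    push_cast
    ring

/-- The idle cycles cancel against the centralizer order. -/
theorem expCoeff_add_idTriple {T : Multiset Triple} (hT : ∀ t ∈ T, 1 ≤ size t.2.1) (Ξ : Ptn) :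
    (normProd (srcSum T + Ξ) : ℂ) * expCoeff (T + Ξ.map idTriple) = seriesCoeff T / mfac Ξ := by
  have h1 : ((Ξ.map idTriple).map connCoeff).prod = 1 / (normProd Ξ : ℂ) := by
    rw [Multiset.map_map]
    induction Ξ using Multiset.induction_on with
    | empty => simp [normProd]
    | cons i Ξ ih =>
      rw [Multiset.map_cons, Multiset.prod_cons, ih, Function.comp_apply, connCoeff_idTriple,
        ← Multiset.singleton_add, normProd_add]
      simp only [normProd, Multiset.map_singleton, Multiset.prod_singleton]
      push_cast
      ring
  have h2 : (normProd Ξ : ℂ) ≠ 0 := Nat.cast_ne_zero.2 (normProd_pos Ξ).ne'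
  rw [expCoeff, autCard_add_idTriple hT, Multiset.map_add, Multiset.prod_add, h1, seriesCoeff_eq,
    normProd_add]
  push_cast
  field_simp

/-- `T ↦ T + {({i}, 0, {i})}_i` identifies the proper series occurring in the operator, applied to
`p_Γ`, with those in the exponential formula. -/
theorem bijOn_add_idTriple (Γ Δ : Ptn) :
    Set.BijOn (fun T : ReSeries Δ => T.1 + (Γ - srcSum T.1).map idTriple)
      {T | srcSum T.1 ≤ Γ ∧ seriesCoeff T.1 ≠ 0}
      {T | (T ∈ admSeries (size Γ) ∧ srcSum T = Γ ∧ midSum T = Δ) ∧ expCoeff T ≠ 0} := by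
  classical
  have hconn : ∀ {T : Multiset Triple}, (T.map connCoeff).prod ≠ 0 → ∀ t ∈ T, connCoeff t ≠ 0 :=
    fun {T} h t ht h0 => h (Multiset.prod_eq_zero (h0 ▸ Multiset.mem_map_of_mem _ ht))
  have hfilter : ∀ (T : ReSeries Δ) (Ξ : Ptn),
      (T.1 + Ξ.map idTriple).filter (fun t => 1 ≤ size t.2.1) = T.1 := by
    intro T Ξ
    rw [Multiset.filter_add, Multiset.filter_eq_self.2 T.2.2, Multiset.filter_eq_nil.2, add_zero]
    intro t ht
    obtain ⟨i, -, rfl⟩ := Multiset.mem_map.1 ht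
    simp [idTriple, size_zero]
  refine ⟨?_, ?_, ?_⟩
  · rintro ⟨T, hT1, hT2⟩ ⟨h1, h2⟩
    simp only at h1 h2
    have hΓ : srcSum T + (Γ - srcSum T) = Γ := add_tsub_cancel_of_le h1
    have hsrc : srcSum (T + (Γ - srcSum T).map idTriple) = Γ := by
      rw [srcSum_add, srcSum_idTriple, hΓ]
    refine ⟨⟨mem_admSeries.2 ⟨by rw [hsrc], fun t ht => ?_⟩, hsrc, ?_⟩, fun h => ?_⟩
    · rcases Multiset.mem_add.1 ht with ht | ht
      · rw [seriesCoeff_eq] at h2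
        exact isAdm_of_connCoeff_ne_zero (hconn (fun h => h2 (by rw [h]; simp)) t ht)
      · obtain ⟨i, -, rfl⟩ := Multiset.mem_map.1 ht
        exact ⟨(size_singleton i).symm ▸ i.pos, by simp [idTriple, size_zero], rfl⟩
    · rw [midSum_add, midSum_idTriple, hT1, add_zero]
    · have := expCoeff_add_idTriple hT2 (Γ - srcSum T)
      rw [h, mul_zero, eq_comm, div_eq_zero_iff] at this
      exact this.elim h2 (Nat.cast_ne_zero.2 (mfac_pos _).ne')
  · intro T _ T' _ h
    refine Subtype.ext ?_
    rw [← hfilter T (Γ - srcSum T.1), ← hfilter T' (Γ - srcSum T'.1)]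
    exact congrArg _ h
  · rintro T' ⟨⟨h1, h2, h3⟩, h4⟩
    have h5 : ∀ t ∈ T', connCoeff t ≠ 0 :=
      hconn fun h => h4 (by rw [expCoeff, h, zero_div])
    obtain ⟨Ξ, hΞ⟩ : ∃ Ξ : Ptn, T'.filter (fun t => ¬1 ≤ size t.2.1) = Ξ.map idTriple := by
      have : ∀ S : Multiset Triple, (∀ t ∈ S, ∃ i, t = idTriple i) → ∃ Ξ : Ptn,
          S = Ξ.map idTriple := by
        intro S
        induction S using Multiset.induction_on with
        | empty => exact fun _ => ⟨0, rfl⟩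
        | cons t S ih =>
          intro h
          obtain ⟨Ξ, hΞ⟩ := ih fun s hs => h s (Multiset.mem_cons_of_mem hs)
          obtain ⟨i, hi⟩ := h t (Multiset.mem_cons_self t S)
          exact ⟨i ::ₘ Ξ, by rw [Multiset.map_cons, ← hi, ← hΞ]⟩
      refine this _ fun t ht => ?_
      rw [Multiset.mem_filter] at ht
      exact eq_idTriple_of_connCoeff_ne_zero (h5 t ht.1) (size_eq_zero_iff.1 (by omega))
    have hT' : T'.filter (fun t => 1 ≤ size t.2.1) + Ξ.map idTriple = T' := by
      rw [← hΞ, Multiset.filter_add_not]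
    set T := T'.filter (fun t => 1 ≤ size t.2.1) with hT
    have hT2 : ∀ t ∈ T, 1 ≤ size t.2.1 := fun t ht => (Multiset.mem_filter.1 ht).2
    have hT1 : midSum T = Δ := by
      rw [← h3, ← hT', midSum_add, midSum_idTriple, add_zero]
    have hsrc : srcSum T + Ξ = Γ := by
      rw [← h2, ← hT', srcSum_add, srcSum_idTriple]
    have hsub : Γ - srcSum T = Ξ := by rw [← hsrc, add_tsub_cancel_left]
    refine ⟨⟨T, hT1, hT2⟩, ⟨hsrc ▸ Multiset.le_add_right _ _, fun h => ?_⟩, ?_⟩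
    · have := expCoeff_add_idTriple hT2 Ξ
      simp only at h
      rw [h, zero_div, hT', mul_eq_zero] at this
      exact this.elim (Nat.cast_ne_zero.2 (normProd_pos _).ne') h4
    · change T + (Γ - srcSum T).map idTriple = T'
      rw [hsub, hT']

end Series

/-! ### The action of the operators on monomials -/

section Operator

variable {R : Type*} [CommRing R]

theorem pMon_eq_monomial (Γ : Ptn) : pMon R Γ = MvPolynomial.monomial (Multiset.toFinsupp Γ) 1 := by
  induction Γ using Multiset.induction_on with
  | empty => simp [pMon]
  | cons i Γ ih =>
    rw [pMon, Multiset.map_cons, Multiset.prod_cons, ← pMon, ih, ← Multiset.singleton_add,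
      map_add, Multiset.toFinsupp_singleton, MvPolynomial.X, MvPolynomial.monomial_mul, one_mul]

theorem pMon_add (Γ Δ : Ptn) : pMon R (Γ + Δ) = pMon R Γ * pMon R Δ := by
  simp [pMon]

theorem pderiv_pMon_cons (i : ℕ+) (Γ : Ptn) :
    MvPolynomial.pderiv i (pMon R (i ::ₘ Γ)) = ((Γ.count i + 1 : ℕ) : R) • pMon R Γ := by
  have h : Multiset.toFinsupp (i ::ₘ Γ) - Finsupp.single i 1 = Multiset.toFinsupp Γ := by
    rw [← Multiset.singleton_add, map_add, Multiset.toFinsupp_singleton, add_tsub_cancel_left]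
  rw [pMon_eq_monomial, MvPolynomial.pderiv_monomial, h, one_mul, Multiset.toFinsupp_apply,
    Multiset.count_cons_self, pMon_eq_monomial, MvPolynomial.smul_monomial, smul_eq_mul, mul_one]

theorem pDiff_eq_zero {Γ Γ' : Ptn} (h : ¬ Γ ≤ Γ') : pDiff Γ (pMon R Γ') = 0 := by
  obtain ⟨c, m', h1, h2⟩ := list_pderiv_monomial (R := R) Γ.sort (Multiset.toFinsupp Γ') 1
  rw [pDiff, pMon_eq_monomial, h1]
  by_cases hc : c = 0
  · rw [hc, MvPolynomial.monomial_zero]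
  · refine absurd (Multiset.le_iff_count.2 fun i => ?_) h
    have h3 := h2 hc i
    rw [← Multiset.coe_count, Multiset.sort_eq, Multiset.toFinsupp_apply] at h3
    omega

variable [Algebra ℂ R]

theorem list_pderiv_pMon (l : List ℕ+) (Ξ : Ptn) :
    (l.map (fun i => ((MvPolynomial.pderiv i).toLinearMap :
      Module.End R (MvPolynomial ℕ+ R)))).prod (pMon R ((l : Ptn) + Ξ)) =
        ((mfac ((l : Ptn) + Ξ) : ℂ) / mfac Ξ) • pMon R Ξ := by
  induction l generalizing Ξ with
  | nil =>
    have : (mfac Ξ : ℂ) ≠ 0 := Nat.cast_ne_zero.2 (mfac_pos Ξ).ne'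
    simp [this]
  | cons j l ih =>
    have h : ((j :: l : List ℕ+) : Ptn) + Ξ = (l : Ptn) + (j ::ₘ Ξ) := by
      rw [← Multiset.cons_coe, Multiset.cons_add, Multiset.add_cons]
    have h1 : (mfac Ξ : ℂ) ≠ 0 := Nat.cast_ne_zero.2 (mfac_pos Ξ).ne'
    have h2 : (Ξ.count j : ℂ) + 1 ≠ 0 := Nat.cast_add_one_ne_zero _
    have h3 : ((Ξ.count j + 1 : ℕ) : R) • pMon R Ξ = ((Ξ.count j : ℂ) + 1) • pMon R Ξ := by
      rw [Nat.cast_smul_eq_nsmul, ← Nat.cast_add_one, Nat.cast_smul_eq_nsmul]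
    rw [List.map_cons, List.prod_cons, Module.End.mul_apply, h, ih (j ::ₘ Ξ),
      LinearMap.map_smul_of_tower, Derivation.coeFn_coe, pderiv_pMon_cons, h3, smul_smul, mfac_cons]
    congr 1
    push_cast
    field_simp

theorem pDiff_pMon (Γ Ξ : Ptn) :
    pDiff Γ (pMon R (Γ + Ξ)) = ((mfac (Γ + Ξ) : ℂ) / mfac Ξ) • pMon R Ξ := by
  have := list_pderiv_pMon (R := R) Γ.sort Ξ
  rwa [Multiset.sort_eq] at this

/-- The monomial `p_Γ` in the rescaled variables `z⁻¹ p_i`. In these variables the operator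
`What z Δ` does not involve `z`. -/
def zMon (z : Rˣ) (Γ : Ptn) : MvPolynomial ℕ+ R := ((z ^ (-(Γ.card : ℤ)) : Rˣ) : R) • pMon R Γ

theorem scaled_WTerm (z : Rˣ) {Γ Δ : Ptn} (T : ReSeries Δ) (h : srcSum T.1 ≤ Γ) :
    ((z ^ (-(size Δ : ℤ) + Δ.card) : Rˣ) : R) • ((z ^ (-(Γ.card : ℤ)) : Rˣ) : R) •
      WTerm z Δ T (pMon R Γ) = ((normProd Γ * mfac Γ : ℕ) : ℂ) •
        expCoeff (T.1 + (Γ - srcSum T.1).map idTriple) •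
          zMon z (tgtSum (T.1 + (Γ - srcSum T.1).map idTriple)) := by
  obtain ⟨Ξ, rfl⟩ := Multiset.le_iff_exists_add.1 h
  have key := expCoeff_add_idTriple T.2.2 Ξ
  rw [add_tsub_cancel_left, WTerm, pDiff_pMon, tgtSum_add, tgtSum_idTriple, zMon, pMon_add,
    Multiset.card_add, Multiset.card_add, mul_smul_comm]
  set P := pMon R (tgtSum T.1) * pMon R Ξ
  rw [smul_smul, smul_smul, ← Units.val_mul, ← Units.val_mul, ← zpow_add, ← zpow_add,
    smul_smul, smul_smul, smul_comm (_ : ℂ) (_ : R) P]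
  congr 1
  · congr 2
    push_cast
    ring
  · congr 1
    push_cast
    rw [mul_right_comm, key]
    ring

/-- The operator in the variables `z⁻¹ p_i`, as a sum over the multisets of triples of the
exponential formula. -/
theorem What_zMon (z : Rˣ) (Δ Γ : Ptn) :
    What z Δ (zMon z Γ) = ((normProd Γ * mfac Γ : ℕ) : ℂ) •
      ∑ T ∈ admSeries (size Γ) with srcSum T = Γ ∧ midSum T = Δ,
        expCoeff T • zMon z (tgtSum T) := by
  classical
  have e1 : What z Δ (zMon z Γ) = ((z ^ (-(size Δ : ℤ) + Δ.card) : Rˣ) : R) •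
      ((z ^ (-(Γ.card : ℤ)) : Rˣ) : R) • ∑ᶠ T : ReSeries Δ, WTerm z Δ T (pMon R Γ) := by
    rw [zMon, map_smul, smul_comm]
    rfl
  have hfin := WTerm_finite z Δ (pMon R Γ)
  have hfin' : (fun T : ReSeries Δ => ((z ^ (-(Γ.card : ℤ)) : Rˣ) : R) •
      WTerm z Δ T (pMon R Γ)).HasFiniteSupport :=
    hfin.subset fun T hT h => hT (by simp only [h, smul_zero])
  rw [e1, smul_finsum' _ hfin, smul_finsum' _ hfin', smul_sum]
  have hsupp : ∀ T : ReSeries Δ, ¬ (srcSum T.1 ≤ Γ ∧ seriesCoeff T.1 ≠ 0) →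
      WTerm z Δ T (pMon R Γ) = 0 := by
    intro T hT
    rw [not_and_or, not_not] at hT
    rcases hT with hT | hT
    · rw [WTerm, pDiff_eq_zero hT, mul_zero, smul_zero, smul_zero]
    · rw [WTerm, hT, zero_smul, smul_zero]
  rw [← finsum_mem_univ, ← finsum_mem_inter_support_eq' (s :=
    {T : ReSeries Δ | srcSum T.1 ≤ Γ ∧ seriesCoeff T.1 ≠ 0})]
  rotate_left
  · intro T hT
    refine iff_of_true ?_ (Set.mem_univ _)
    by_contra h
    exact hT (by simp only [hsupp T h, smul_zero])
  rw [finsum_mem_eq_of_bijOn _ (bijOn_add_idTriple Γ Δ) (fun T hT => scaled_WTerm z T hT.1)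
    (g := fun T => ((normProd Γ * mfac Γ : ℕ) : ℂ) • expCoeff T • zMon z (tgtSum T)),
    ← finsum_mem_coe_finset]
  refine finsum_mem_inter_support_eq' _ _ _ fun T hT => ?_
  rw [mem_coe, mem_filter]
  refine ⟨fun h => h.1, fun h => ⟨h, fun h0 => hT ?_⟩⟩
  simp only [h0, zero_smul, smul_zero]

variable {α : Type*} [Fintype α] [DecidableEq α]

open Classical in
/-- Sums over partial permutations of type `Δ`, as sums over permutations of type
`[Δ, 1^(n-|Δ|)]`. -/
theorem sum_partialPerm {M : Type*} [AddCommGroup M] [Module ℂ M] (Δ : Ptn) (F : Perm α → M) :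
    ∑ p : Finset α × Perm α with p.2.support ⊆ p.1 ∧ ctype p.1 p.2 = Δ, F p.2 =
      (shiftBinom (Fintype.card α) Δ : ℂ) •
        ∑ f : Perm α with ctype univ f = shift (Fintype.card α) Δ, F f := by
  rw [sum_filter, Fintype.sum_prod_type_right, smul_sum, sum_filter (s := univ)]
  refine sum_congr rfl fun f _ => ?_
  have h := card_support_superset (subset_univ f.support) Δ
  simp only [subset_univ, true_and] at h
  simp only
  rw [← sum_filter, sum_const, h, card_univ]
  split_ifs
  · rw [Nat.cast_smul_eq_nsmul]
  · rw [zero_smul]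

open Classical in
/-- When `s` stands for its cycle type, the operator is the multiplication from the right by the
sum of the partial permutations of type `Δ`, which is `shiftBinom` times a class sum. -/
theorem What_zMon_ctype (z : Rˣ) (Δ : Ptn) (s : Perm α) :
    What z Δ (zMon z (ctype univ s)) = (shiftBinom (Fintype.card α) Δ : ℂ) •
      ∑ f : Perm α with ctype univ f = shift (Fintype.card α) Δ, zMon z (ctype univ (s * f)) := by
  set Γ := ctype univ s with hΓ
  set Q : Perm α → MvPolynomial ℕ+ R := fun s => (shiftBinom (Fintype.card α) Δ : ℂ) •
      ∑ f : Perm α with ctype univ f = shift (Fintype.card α) Δ, zMon z (ctype univ (s * f))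
    with hQ
  have hsz : size Γ = Fintype.card α := size_ctype_univ s
  have h1 := sum_permPairs_eq (α := α)
    (fun τ : Triple => if τ.1 = Γ ∧ τ.2.1 = Δ then zMon z τ.2.2 else 0) univ
  have h2 : ∑ x ∈ permPairs (univ : Finset α),
      (fun τ : Triple => if τ.1 = Γ ∧ τ.2.1 = Δ then zMon z τ.2.2 else 0) (pairType univ x) =
      ∑ s' : Perm α with ctype univ s' = Γ, Q s' := by
    have h3 : ∀ s' : Perm α, Q s' = ∑ p : Finset α × Perm α with
        p.2.support ⊆ p.1 ∧ ctype p.1 p.2 = Δ, zMon z (ctype univ (s' * p.2)) :=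
      fun s' => (sum_partialPerm Δ (fun f => zMon z (ctype univ (s' * f)))).symm
    simp_rw [h3, sum_filter]
    rw [permPairs, sum_filter, Fintype.sum_prod_type]
    refine sum_congr rfl fun s' _ => ?_
    by_cases hs : ctype univ s' = Γ
    · simp only [pairType, hs, if_true, true_and, subset_univ]
      refine sum_congr rfl fun p _ => ?_
      by_cases hp : p.2.support ⊆ p.1
      · simp [hp]
      · simp [hp]
    · simp [pairType, hs]
  have h4 : ∀ s' ∈ (Finset.univ.filter fun s' : Perm α => ctype univ s' = Γ), Q s' = Q s := by
    intro s' hs'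
    obtain ⟨w, hw⟩ := isConj_iff.1 ((ctype_univ_eq_iff_isConj s s').1 (mem_filter.1 hs').2.symm)
    rw [hQ]
    simp only
    congr 1
    symm
    refine sum_equiv (MulAut.conj w).toEquiv (fun f => ?_) (fun f _ => ?_)
    · simp only [mem_filter, mem_univ, true_and]
      rw [(ctype_univ_eq_iff_isConj f _).2 (isConj_iff.2 ⟨w, rfl⟩)]
      rfl
    · congr 1
      refine (ctype_univ_eq_iff_isConj _ _).2 (isConj_iff.2 ⟨w, ?_⟩)
      rw [← hw]
      change _ = _ * (w * f * w⁻¹)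
      group
  have h5 : ∑ T ∈ admSeries (size Γ) with srcSum T = Γ ∧ midSum T = Δ,
      expCoeff T • zMon z (tgtSum T) = ∑ T ∈ admSeries #(univ : Finset α), expCoeff T •
        (fun τ : Triple => if τ.1 = Γ ∧ τ.2.1 = Δ then zMon z τ.2.2 else 0) T.sum := by
    rw [card_univ, ← hsz, sum_filter]
    refine sum_congr rfl fun T _ => ?_
    simp only [sum_triples]
    split_ifs
    · rfl
    · rw [smul_zero]
  rw [h2, sum_congr rfl h4, sum_const, ← h5, card_univ] at h1
  have h6 : ((Fintype.card α)! : ℂ) ≠ 0 := Nat.cast_ne_zero.2 (Nat.factorial_ne_zero _)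
  rw [What_zMon]
  refine smul_right_injective _ h6 ?_
  change _ • _ • _ = _ • Q s
  rw [smul_comm, ← h1, ← card_class_mul hsz, ← Nat.cast_smul_eq_nsmul ℂ, smul_smul,
    ← Nat.cast_mul, mul_comm]

end Operator

/-! ### Partial permutations and the basis of the limit algebra -/

section PartialPermutations

variable {n : ℕ}

theorem PartialPerm.apply_mem_range_iff {a : PartialPerm} (ha : a ∈ PP n) (x : ℕ) :
    a.perm x ∈ range n ↔ x ∈ range n := by
  by_cases hx : x ∈ a.supp
  · exact iff_of_true (ha ((a.perm_mem_iff x).2 hx)) (ha hx)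
  · rw [a.fix x hx]

/-- The permutation of `{0, …, n - 1}` underlying a partial permutation. -/
def toPerm (n : ℕ) : PP n →* Perm {x // x ∈ range n} where
  toFun a := a.1.perm.subtypePerm (PartialPerm.apply_mem_range_iff a.2)
  map_one' := rfl
  map_mul' _ _ := rfl

/-- The support of a partial permutation, as a subset of `{0, …, n - 1}`. -/
def toSupp (a : PP n) : Finset {x // x ∈ range n} := a.1.supp.subtype (· ∈ range n)

theorem mem_toSupp {a : PP n} {x : {x // x ∈ range n}} : x ∈ toSupp a ↔ (x : ℕ) ∈ a.1.supp := by
  simp [toSupp]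

theorem support_toPerm_subset (a : PP n) : (toPerm n a).support ⊆ toSupp a := fun x hx => by
  rw [mem_toSupp]
  by_contra h
  exact Perm.mem_support.1 hx (Subtype.ext (a.1.fix x h))

theorem isOfType_iff (a : PP n) (Δ : Ptn) :
    a.1.IsOfType Δ ↔ ctype (toSupp a) (toPerm n a) = Δ := by
  have hmem : ∀ x, toPerm n a x ∈ toSupp a ↔ x ∈ toSupp a :=
    apply_mem_iff (support_toPerm_subset a)
  rw [← hasType_subtypePerm (support_toPerm_subset a) hmem, PartialPerm.IsOfType]
  let e : {x // x ∈ toSupp a} ≃ {x // x ∈ a.1.supp} :=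
    { toFun := fun x => ⟨x.1.1, mem_toSupp.1 x.2⟩
      invFun := fun x => ⟨⟨x.1, a.2 x.2⟩, mem_toSupp.2 x.2⟩
      left_inv := fun _ => rfl
      right_inv := fun _ => rfl }
  rw [← hasType_permCongr e]
  rfl

theorem toSupp_toPerm_injective {a b : PP n} (h1 : toSupp a = toSupp b)
    (h2 : toPerm n a = toPerm n b) : a = b := by
  have hs : a.1.supp = b.1.supp := by
    ext x
    constructor
    · intro hx
      have : (⟨x, a.2 hx⟩ : {x // x ∈ range n}) ∈ toSupp a := mem_toSupp.2 hx
      rw [h1] at this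
      exact mem_toSupp.1 this
    · intro hx
      have : (⟨x, b.2 hx⟩ : {x // x ∈ range n}) ∈ toSupp b := mem_toSupp.2 hx
      rw [← h1] at this
      exact mem_toSupp.1 this
  refine Subtype.ext (PartialPerm.ext hs (Equiv.ext fun x => ?_))
  by_cases hx : x ∈ a.1.supp
  · exact congrArg (fun f : Perm {x // x ∈ range n} => ((f ⟨x, a.2 hx⟩ : _) : ℕ)) h2
  · rw [a.1.fix x hx, b.1.fix x (hs ▸ hx)]

theorem exists_toSupp_toPerm {E : Finset {x // x ∈ range n}} {f : Perm {x // x ∈ range n}}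
    (h : f.support ⊆ E) : ∃ a : PP n, toSupp a = E ∧ toPerm n a = f := by
  have hf : ∀ x ∉ E.map (Function.Embedding.subtype _), Perm.ofSubtype f x = x := by
    intro x hx
    by_cases hxn : x ∈ range n
    · rw [Perm.ofSubtype_apply_of_mem _ hxn, apply_eq_of_notMem h]
      exact fun h => hx (mem_map.2 ⟨_, h, rfl⟩)
    · exact Perm.ofSubtype_apply_of_not_mem _ hxn
  refine ⟨⟨⟨E.map (Function.Embedding.subtype _), Perm.ofSubtype f, hf⟩, fun x hx => ?_⟩, ?_, ?_⟩
  · obtain ⟨y, -, rfl⟩ := mem_map.1 hx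
    exact y.2
  · ext x
    rw [mem_toSupp]
    exact mem_map' (Function.Embedding.subtype _)
  · refine Equiv.ext fun x => Subtype.ext ?_
    change Perm.ofSubtype f x = f x
    rw [Perm.ofSubtype_apply_coe]

open Classical in
theorem sum_isOfType {M : Type*} [AddCommGroup M] [Module ℂ M] (n : ℕ) (Δ : Ptn)
    (F : Perm {x // x ∈ range n} → M) :
    ∑ a : PP n with a.1.IsOfType Δ, F (toPerm n a) =
      (shiftBinom n Δ : ℂ) •
        ∑ f : Perm {x // x ∈ range n} with ctype univ f = shift n Δ, F f := by
  have h := sum_partialPerm (α := {x // x ∈ range n}) Δ F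
  rw [Fintype.card_coe, card_range] at h
  rw [← h]
  refine sum_bij (fun a _ => (toSupp a, toPerm n a)) (fun a ha => ?_) (fun a _ b _ h => ?_)
    (fun p hp => ?_) (fun _ _ => rfl)
  · rw [mem_filter, isOfType_iff] at ha
    exact mem_filter.2 ⟨mem_univ _, support_toPerm_subset a, ha.2⟩
  · exact toSupp_toPerm_injective (congrArg Prod.fst h) (congrArg Prod.snd h)
  · rw [mem_filter] at hp
    obtain ⟨a, h1, h2⟩ := exists_toSupp_toPerm hp.2.1
    exact ⟨a, mem_filter.2 ⟨mem_univ _, (isOfType_iff a Δ).2 (by rw [h1, h2]; exact hp.2.2)⟩,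
      Prod.ext h1 h2⟩

/-- Every partition is the type of a partial permutation with support `{0, …, |Δ| - 1}`. -/
theorem exists_isOfType (Δ : Ptn) : ∃ a : PP (size Δ), a.1.IsOfType Δ := by
  have h := card_class_mul (α := {x // x ∈ range (size Δ)}) (Γ := Δ)
    (by rw [Fintype.card_coe, card_range])
  have h1 : #{f : Perm {x // x ∈ range (size Δ)} | ctype univ f = Δ} ≠ 0 := by
    intro h0
    rw [h0, zero_mul] at h
    exact Nat.factorial_ne_zero _ h.symm
  obtain ⟨f, hf⟩ := card_ne_zero.1 h1
  obtain ⟨a, ha1, ha2⟩ := exists_toSupp_toPerm (subset_univ f.support)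
  exact ⟨a, (isOfType_iff a Δ).2 (by rw [ha1, ha2]; exact (mem_filter.1 hf).2)⟩

theorem isOfType_unique {a : PartialPerm} {Δ Δ' : Ptn} (h : a.IsOfType Δ) (h' : a.IsOfType Δ') :
    Δ = Δ' :=
  map_coe_injective (h.symm.trans h')

theorem exists_ptn_isOfType (a : PP n) : ∃ Δ, a.1.IsOfType Δ := ⟨_, (isOfType_iff a _).2 rfl⟩

/-- Partial permutations of the same type are conjugate under `S_n`. -/
theorem exists_conjHom_eq {a b : PP n} {Δ : Ptn} (ha : a.1.IsOfType Δ) (hb : b.1.IsOfType Δ) :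
    ∃ v : Sym n, conjHom v a = b := by
  have hcard : Fintype.card {x // x ∈ a.1.supp} = Fintype.card {x // x ∈ b.1.supp} := by
    rw [Fintype.card_coe, Fintype.card_coe, PartialPerm.isOfType_card ha,
      PartialPerm.isOfType_card hb]
  let e := Fintype.equivOfCardEq hcard
  have h1 : HasType (e.permCongr a.1.restr) Δ := (hasType_permCongr e _ _).2 ha
  obtain ⟨w, hw⟩ := isConj_iff.1 ((ctype_univ_eq_iff_isConj _ _).1
    (((hasType_iff _ _).1 h1).trans ((hasType_iff _ _).1 hb).symm))
  -- `e'` is an isomorphism of the two permutations of the supports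
  let e' : {x // x ∈ a.1.supp} ≃ {x // x ∈ b.1.supp} := e.trans w
  have he' : ∀ x, e' (a.1.restr x) = b.1.restr (e' x) := by
    intro x
    rw [← hw]
    simp [e']
  let e₀ : {x : {x // x ∈ range n} // x ∈ toSupp a} ≃ {x : {x // x ∈ range n} // x ∈ toSupp b} :=
    { toFun := fun x => ⟨⟨e' ⟨x.1.1, mem_toSupp.1 x.2⟩, b.2 (e' _).2⟩, mem_toSupp.2 (e' _).2⟩
      invFun := fun x => ⟨⟨e'.symm ⟨x.1.1, mem_toSupp.1 x.2⟩, a.2 (e'.symm _).2⟩,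
        mem_toSupp.2 (e'.symm _).2⟩
      left_inv := fun x => by simp
      right_inv := fun x => by simp }
  let v : Perm ℕ := Perm.ofSubtype e₀.extendSubtype
  have hv : ∀ x (hx : x ∈ a.1.supp), v x = e' ⟨x, hx⟩ := by
    intro x hx
    change Perm.ofSubtype e₀.extendSubtype x = _
    rw [Perm.ofSubtype_apply_of_mem _ (a.2 hx),
      e₀.extendSubtype_apply_of_mem ⟨x, a.2 hx⟩ (mem_toSupp.2 hx)]
    rfl
  have hvn : ∀ x, n ≤ x → v x = x := fun x hx =>
    Perm.ofSubtype_apply_of_not_mem _ (by rwa [mem_range, not_lt])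
  have hsupp : a.1.supp.map v.toEmbedding = b.1.supp := by
    refine eq_of_subset_of_card_le (fun y hy => ?_) ?_
    · obtain ⟨x, hx, rfl⟩ := mem_map.1 hy
      change v x ∈ _
      rw [hv x hx]
      exact (e' _).2
    · rw [card_map, PartialPerm.isOfType_card ha, PartialPerm.isOfType_card hb]
  refine ⟨⟨v, hvn⟩, Subtype.ext (PartialPerm.ext hsupp (Equiv.ext fun y => ?_))⟩
  change (v * a.1.perm * v⁻¹) y = b.1.perm y
  obtain ⟨x, rfl⟩ := v.surjective y
  rw [Perm.mul_apply, Perm.mul_apply, show v⁻¹ (v x) = x from v.symm_apply_apply x]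
  by_cases hx : x ∈ a.1.supp
  · rw [hv _ ((a.1.perm_mem_iff x).2 hx), hv x hx]
    exact congrArg Subtype.val (he' ⟨x, hx⟩)
  · rw [a.1.fix x hx, b.1.fix]
    rw [← hsupp]
    exact fun h => hx ((mem_map' v.toEmbedding).1 h)

end PartialPermutations

section Limit

variable {n : ℕ}

theorem conjHom_injective (v : Sym n) : Function.Injective (conjHom v) := by
  intro a b hab
  have h0 : a.1.conj v = b.1.conj v := congrArg Subtype.val hab
  have h1 := congrArg PartialPerm.supp h0
  have h2 := congrArg PartialPerm.perm h0
  simp only [PartialPerm.conj, mul_left_inj, mul_right_inj] at h1 h2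
  exact Subtype.ext (PartialPerm.ext (Finset.map_injective _ h1) h2)

theorem mem_AAlg_iff {x : BAlg n} :
    x ∈ AAlg n ↔ ∀ v : Sym n, MonoidAlgebra.mapDomainAlgHom ℂ ℂ (conjHom v) x = x :=
  Algebra.mem_iInf

theorem coeff_conjHom {x : BAlg n} (hx : x ∈ AAlg n) (v : Sym n) (a : PP n) :
    x.coeff (conjHom v a) = x.coeff a := by
  have h := mem_AAlg_iff.1 hx v
  conv_lhs => rw [← h]
  exact Finsupp.mapDomain_apply (conjHom_injective v) _ _

/-- The coefficients of an invariant element depend only on the type. -/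
theorem coeff_eq_of_isOfType {x : BAlg n} (hx : x ∈ AAlg n) {a b : PP n} {Δ : Ptn}
    (ha : a.1.IsOfType Δ) (hb : b.1.IsOfType Δ) : x.coeff a = x.coeff b := by
  obtain ⟨v, rfl⟩ := exists_conjHom_eq ha hb
  exact (coeff_conjHom hx v a).symm

theorem PP_mono {m n : ℕ} (h : m ≤ n) : PP m ≤ PP n := fun _ ha _ hx =>
  mem_range.2 ((mem_range.1 (ha hx)).trans_le h)

theorem coeff_theta {m n : ℕ} (h : m ≤ n) (x : BAlg n) (a : PP m) :
    (theta n m x).coeff a = x.coeff ⟨a.1, PP_mono h a.2⟩ := by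
  classical
  induction x using MonoidAlgebra.induction_linear with
  | zero => simp
  | add x y hx hy => rw [map_add, MonoidAlgebra.coeff_add, MonoidAlgebra.coeff_add,
      Finsupp.add_apply, Finsupp.add_apply, hx, hy]
  | single b r =>
    rw [theta, MonoidAlgebra.lift_single]
    change (r • if h : b.1 ∈ PP m then MonoidAlgebra.single (⟨b.1, h⟩ : PP m) (1 : ℂ) else 0).coeff a
      = _
    split_ifs with hb
    · simp only [MonoidAlgebra.smul_single, smul_eq_mul, mul_one, MonoidAlgebra.coeff_single,
        Finsupp.single_apply, Subtype.ext_iff]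
    · rw [smul_zero, MonoidAlgebra.coeff_zero, Finsupp.zero_apply, MonoidAlgebra.coeff_single,
        Finsupp.single_apply, if_neg]
      rintro rfl
      exact hb a.2

/-- Invariant elements of `B_n` are central: for `b = (E, f)` and `v = f` one has
`b a = (v a v⁻¹) b`, as the supports `E ∪ E'` and `f E' ∪ E` agree. -/
theorem AAlg_comm {x : BAlg n} (hx : x ∈ AAlg n) (y : BAlg n) : x * y = y * x := by
  classical
  induction y using MonoidAlgebra.induction_linear with
  | zero => simp
  | add y z hy hz => rw [mul_add, add_mul, hy, hz]
  | single b r =>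
    let v : Sym n := ⟨b.1.perm, fun k hk => b.1.fix k fun h =>
      absurd (mem_range.1 (b.2 h)) (not_lt.2 hk)⟩
    have key : ∀ a : PP n, b * a = conjHom v a * b := by
      intro a
      refine Subtype.ext (PartialPerm.ext ?_ ?_)
      · change b.1.supp ∪ a.1.supp = a.1.supp.map b.1.perm.toEmbedding ∪ b.1.supp
        ext k
        rw [mem_union, mem_union, mem_map_equiv]
        by_cases hk : k ∈ b.1.supp
        · simp [hk]
        · have : b.1.perm.symm k = k := by
            rw [Equiv.symm_apply_eq, b.1.fix k hk]
          simp [hk, this]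
      · change b.1.perm * a.1.perm = b.1.perm * a.1.perm * b.1.perm⁻¹ * b.1.perm
        group
    have h : ∀ x : BAlg n, MonoidAlgebra.single b r * x =
        MonoidAlgebra.mapDomainAlgHom ℂ ℂ (conjHom v) x * MonoidAlgebra.single b r := by
      intro x
      induction x using MonoidAlgebra.induction_linear with
      | zero => simp
      | add x y hx hy => rw [mul_add, hx, hy, map_add, add_mul]
      | single a t =>
        rw [MonoidAlgebra.mapDomainAlgHom_apply, MonoidAlgebra.mapDomain_single,
          MonoidAlgebra.single_mul_single, MonoidAlgebra.single_mul_single, key, mul_comm r]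
    rw [h x, mem_AAlg_iff.1 hx v]

theorem AInf_mul_comm (x y : AInf) : x * y = y * x :=
  Subtype.ext (funext fun n => AAlg_comm (x.2.1 n) (y.1 n))

theorem AElt_coeff (Δ : Ptn) (n : ℕ) (a : PP n) [Decidable (a.1.IsOfType Δ)] :
    ((AElt Δ).1 n).coeff a = if a.1.IsOfType Δ then 1 else 0 :=
  classSum_coeff n Δ a

/-- The coefficient of a sequence at the partial permutations of type `Δ`. -/
def typeCoeff (Δ : Ptn) (x : ∀ n, BAlg n) : ℂ :=
  (x (size Δ)).coeff (exists_isOfType Δ).choose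

theorem coeff_eq_typeCoeff {x : ∀ n, BAlg n} (hx : x ∈ AInf) {a : PP n} {Δ : Ptn}
    (ha : a.1.IsOfType Δ) : (x n).coeff a = typeCoeff Δ x := by
  have hn : size Δ ≤ n := by
    rw [← PartialPerm.isOfType_card ha]
    exact (card_le_card a.2).trans_eq (card_range n)
  rw [typeCoeff, ← hx.2.1 _ _ hn, coeff_theta hn]
  exact coeff_eq_of_isOfType (hx.1 n) ha (exists_isOfType Δ).choose_spec

theorem typeCoeff_AElt (Δ Δ' : Ptn) [Decidable (Δ = Δ')] :
    typeCoeff Δ (AElt Δ').1 = if Δ = Δ' then 1 else 0 := by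
  classical
  have h := (exists_isOfType Δ).choose_spec
  rw [typeCoeff, AElt_coeff]
  refine if_congr ⟨fun h' => isOfType_unique h h', ?_⟩ rfl rfl
  rintro rfl
  exact h

theorem typeCoeff_sum (Δ : Ptn) (s : Finset Ptn) (c : Ptn → ℂ) :
    typeCoeff Δ (∑ i ∈ s, c i • AElt i : AInf).1 = if Δ ∈ s then c Δ else 0 := by
  classical
  have h : typeCoeff Δ (∑ i ∈ s, c i • AElt i : AInf).1 =
      ∑ i ∈ s, c i * typeCoeff Δ (AElt i).1 := by
    simp [typeCoeff, MonoidAlgebra.coeff_sum]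
  rw [h]
  simp [typeCoeff_AElt]

theorem linearIndependent_AElt : LinearIndependent ℂ AElt := by
  classical
  refine linearIndependent_iff'.2 fun s c h Δ hΔ => ?_
  have := typeCoeff_sum Δ s c
  rw [h, if_pos hΔ] at this
  rw [← this]
  simp [typeCoeff]

theorem span_AElt : ⊤ ≤ Submodule.span ℂ (Set.range AElt) := by
  classical
  rintro x -
  obtain ⟨d, hd⟩ := x.2.2.2
  have hx : x = ∑ Δ ∈ (size_finite d).toFinset, typeCoeff Δ x.1 • AElt Δ := by
    refine Subtype.ext (funext fun n => MonoidAlgebra.coeff_injective (Finsupp.ext fun a => ?_))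
    obtain ⟨Δ, hΔ⟩ := exists_ptn_isOfType a
    rw [coeff_eq_typeCoeff x.2 hΔ, coeff_eq_typeCoeff (Subtype.prop _) hΔ, typeCoeff_sum]
    split_ifs with h
    · rfl
    · by_contra h0
      rw [← coeff_eq_typeCoeff x.2 hΔ] at h0
      refine h ((size_finite d).mem_toFinset.2 ?_)
      rw [Set.mem_ofPred_eq, ← PartialPerm.isOfType_card hΔ]
      exact hd n a h0
  rw [hx]
  exact Submodule.sum_mem _ fun Δ _ =>
    Submodule.smul_mem _ _ (Submodule.subset_span (Set.mem_range_self Δ))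

/-- The basis `A_Δ` of `A_∞`. -/
def basisAInf : Module.Basis Ptn ℂ AInf := Module.Basis.mk linearIndependent_AElt span_AElt

theorem basisAInf_apply (Δ : Ptn) : basisAInf Δ = AElt Δ := Module.Basis.mk_apply _ _ Δ

end Limit

/-! ### Young symmetrizers and central elements -/

section YoungSymmetrizer

variable {lam : YoungDiagram}

/-- The permutation preserves the rows of the diagram. -/
def IsRowPerm (r : CellPerm lam) : Prop := ∀ x, (r x).1.1 = x.1.1

/-- The permutation preserves the columns of the diagram. -/
def IsColPerm (c : CellPerm lam) : Prop := ∀ x, (c x).1.2 = x.1.2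

theorem IsRowPerm.mul {r r' : CellPerm lam} (h : IsRowPerm r) (h' : IsRowPerm r') :
    IsRowPerm (r * r') := fun x => (h _).trans (h' x)

theorem IsRowPerm.inv {r : CellPerm lam} (h : IsRowPerm r) : IsRowPerm r⁻¹ := fun x => by
  rw [← h (r⁻¹ x), ← Perm.mul_apply, mul_inv_cancel, Perm.one_apply]

theorem IsColPerm.mul {c c' : CellPerm lam} (h : IsColPerm c) (h' : IsColPerm c') :
    IsColPerm (c * c') := fun x => (h _).trans (h' x)

theorem IsColPerm.inv {c : CellPerm lam} (h : IsColPerm c) : IsColPerm c⁻¹ := fun x => by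
  rw [← h (c⁻¹ x), ← Perm.mul_apply, mul_inv_cancel, Perm.one_apply]

/-- If `h` sends cells of the same row to different columns, then moving every cell `x` within its
row to the column of `h x` stays inside the diagram. Indeed, for every `k` the number of cells `x`
with `h x` in one of the first `k` columns is the number of cells in these columns, and there are
at most as many in each row; so equality holds in each row, in particular for `k` the length of the
row of `x`. -/
theorem mem_of_row_col {h : CellPerm lam}
    (hh : ∀ a b, a ≠ b → a.1.1 = b.1.1 → (h a).1.2 ≠ (h b).1.2) (x : {c // c ∈ lam.cells}) :
    (x.1.1, (h x).1.2) ∈ lam.cells := by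
  classical
  set k := lam.rowLen x.1.1
  set I : Finset ℕ := univ.image fun a : {c // c ∈ lam.cells} => a.1.1
  let A : ℕ → Finset {c // c ∈ lam.cells} := fun i => {a | a.1.1 = i ∧ a.1.2 < k}
  let B : ℕ → Finset {c // c ∈ lam.cells} := fun i => {a | a.1.1 = i ∧ (h a).1.2 < k}
  have hBA : ∀ i ∈ I, #(B i) ≤ #(A i) := by
    intro i _
    rcases le_or_gt k (lam.rowLen i) with hk | hk
    · have h1 : #(A i) = k := by
        have : (A i).image (fun a => a.1.2) = range k := by
          ext j
          simp only [A, mem_image, mem_filter, mem_univ, true_and, mem_range]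
          constructor
          · rintro ⟨a, ⟨-, ha⟩, rfl⟩
            exact ha
          · intro hj
            exact ⟨⟨(i, j), (YoungDiagram.mem_cells _).2
              (YoungDiagram.mem_iff_lt_rowLen.2 (hj.trans_le hk))⟩, ⟨rfl, hj⟩, rfl⟩
        rw [← card_range k, ← this, card_image_of_injOn]
        intro a ha b hb hab
        simp only [A, coe_filter, mem_univ, true_and, Set.mem_ofPred_eq] at ha hb
        exact Subtype.ext (Prod.ext (ha.1.trans hb.1.symm) hab)
      rw [h1, ← card_range k]
      refine card_le_card_of_injOn (fun a => (h a).1.2) (fun a ha => ?_) (fun a ha b hb hab => ?_)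
      · simp only [B, mem_coe, mem_filter, mem_univ, true_and] at ha
        exact mem_coe.2 (mem_range.2 ha.2)
      · simp only [B, mem_coe, mem_filter, mem_univ, true_and] at ha hb
        by_contra hne
        exact hh a b hne (ha.1.trans hb.1.symm) hab
    · refine card_le_card fun a ha => ?_
      simp only [A, B, mem_filter, mem_univ, true_and] at ha ⊢
      refine ⟨ha.1, lt_trans ?_ hk⟩
      rw [← ha.1]
      exact YoungDiagram.mem_iff_lt_rowLen.1 ((YoungDiagram.mem_cells _).1 a.2)
  have hsum : ∑ i ∈ I, #(B i) = ∑ i ∈ I, #(A i) := by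
    have e1 : #{a : {c // c ∈ lam.cells} | (h a).1.2 < k} = ∑ i ∈ I, #(B i) := by
      rw [card_eq_sum_card_fiberwise (f := fun a => a.1.1) (t := I)
        (fun a _ => mem_coe.2 (mem_image_of_mem _ (mem_univ a)))]
      refine sum_congr rfl fun i _ => ?_
      rw [filter_filter]
      exact congrArg card (filter_congr fun a _ => and_comm)
    have e2 : #{a : {c // c ∈ lam.cells} | a.1.2 < k} = ∑ i ∈ I, #(A i) := by
      rw [card_eq_sum_card_fiberwise (f := fun a => a.1.1) (t := I)
        (fun a _ => mem_coe.2 (mem_image_of_mem _ (mem_univ a)))]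
      refine sum_congr rfl fun i _ => ?_
      rw [filter_filter]
      exact congrArg card (filter_congr fun a _ => and_comm)
    rw [← e1, ← e2]
    exact card_equiv h fun a => by simp
  have hx := (sum_eq_sum_iff_of_le hBA).1 hsum x.1.1 (mem_image_of_mem _ (mem_univ x))
  have hsub : B x.1.1 ⊆ A x.1.1 := by
    intro a ha
    simp only [A, B, mem_filter, mem_univ, true_and] at ha ⊢
    refine ⟨ha.1, ?_⟩
    change _ < lam.rowLen x.1.1
    rw [← ha.1]
    exact YoungDiagram.mem_iff_lt_rowLen.1 ((YoungDiagram.mem_cells _).1 a.2)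
  have hxA : x ∈ A x.1.1 := by
    simp only [A, mem_filter, mem_univ, true_and]
    exact YoungDiagram.mem_iff_lt_rowLen.1 ((YoungDiagram.mem_cells _).1 x.2)
  rw [← eq_of_subset_of_card_le hsub hx.ge] at hxA
  simp only [B, mem_filter, mem_univ, true_and] at hxA
  exact (YoungDiagram.mem_cells _).2 (YoungDiagram.mem_iff_lt_rowLen.2 hxA)

/-- A permutation is the product of a row permutation and a column permutation, unless two cells of
the same row come from the same column. -/
theorem exists_row_mul_col (g : CellPerm lam) :
    (∃ r c, IsRowPerm r ∧ IsColPerm c ∧ g = r * c) ∨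
      ∃ a b, a ≠ b ∧ a.1.1 = b.1.1 ∧ (g⁻¹ a).1.2 = (g⁻¹ b).1.2 := by
  by_cases hh : ∀ a b, a ≠ b → a.1.1 = b.1.1 → (g⁻¹ a).1.2 ≠ (g⁻¹ b).1.2
  · left
    let q₀ : {c // c ∈ lam.cells} → {c // c ∈ lam.cells} := fun x => ⟨_, mem_of_row_col hh x⟩
    have hq : Function.Injective q₀ := by
      intro a b hab
      have h1 : (a.1.1, (g⁻¹ a).1.2) = (b.1.1, (g⁻¹ b).1.2) := congrArg Subtype.val hab
      by_contra hne
      exact hh a b hne (Prod.mk.inj h1).1 (Prod.mk.inj h1).2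
    let q : CellPerm lam := Equiv.ofBijective q₀ (Finite.injective_iff_bijective.1 hq)
    have hqr : IsRowPerm q := fun _ => rfl
    refine ⟨q⁻¹, q * g, hqr.inv, fun x => ?_, by group⟩
    change (g⁻¹ (g x)).1.2 = x.1.2
    rw [← Perm.mul_apply, inv_mul_cancel, Perm.one_apply]
  · right
    push Not at hh
    exact hh

theorem isRowPerm_swap {a b : {c // c ∈ lam.cells}} (h : a.1.1 = b.1.1) :
    IsRowPerm (Equiv.swap a b) := by
  intro x
  rw [Equiv.swap_apply_def]
  split_ifs with h1 h2
  · rw [h1, h]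
  · rw [h2, h]
  · rfl

theorem isColPerm_swap {a b : {c // c ∈ lam.cells}} (h : a.1.2 = b.1.2) :
    IsColPerm (Equiv.swap a b) := by
  intro x
  rw [Equiv.swap_apply_def]
  split_ifs with h1 h2
  · rw [h1, h]
  · rw [h2, h]
  · rfl

/-- `x` is invariant under row permutations on the left and alternating under column permutations
on the right. -/
def IsRowColInvariant (x : MonoidAlgebra ℂ (CellPerm lam)) : Prop :=
  (∀ r, IsRowPerm r → MonoidAlgebra.single r 1 * x = x) ∧
    ∀ c, IsColPerm c → x * MonoidAlgebra.single c 1 = ((Perm.sign c : ℤ) : ℂ) • x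

theorem IsRowColInvariant.coeff_left {x : MonoidAlgebra ℂ (CellPerm lam)}
    (hx : IsRowColInvariant x) {r : CellPerm lam} (hr : IsRowPerm r) (g : CellPerm lam) :
    x.coeff (r * g) = x.coeff g := by
  conv_lhs => rw [← hx.1 r hr]
  rw [MonoidAlgebra.coeff_single_mul_apply, one_mul, inv_mul_cancel_left]

theorem IsRowColInvariant.coeff_right {x : MonoidAlgebra ℂ (CellPerm lam)}
    (hx : IsRowColInvariant x) {c : CellPerm lam} (hc : IsColPerm c) (g : CellPerm lam) :
    x.coeff (g * c) = ((Perm.sign c : ℤ) : ℂ) * x.coeff g := by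
  have h := congrArg (fun y => y.coeff (g * c)) (hx.2 c hc)
  simp only [MonoidAlgebra.coeff_mul_single_apply, mul_inv_cancel_right, mul_one,
    MonoidAlgebra.coeff_smul, Finsupp.smul_apply, smul_eq_mul] at h
  rw [h, ← mul_assoc, ← Int.cast_mul, ← Units.val_mul, Int.units_mul_self, Units.val_one,
    Int.cast_one, one_mul]

/-- Von Neumann's lemma: the invariance determines `x` up to a scalar. -/
theorem IsRowColInvariant.eq {x y : MonoidAlgebra ℂ (CellPerm lam)}
    (hx : IsRowColInvariant x) (hy : IsRowColInvariant y) (h : x.coeff 1 = y.coeff 1) : x = y := by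
  refine MonoidAlgebra.coeff_injective (Finsupp.ext fun g => ?_)
  rcases exists_row_mul_col g with ⟨r, c, hr, hc, rfl⟩ | ⟨a, b, hab, hrow, hcol⟩
  · have key : ∀ {x : MonoidAlgebra ℂ (CellPerm lam)}, IsRowColInvariant x →
        x.coeff (r * c) = ((Perm.sign c : ℤ) : ℂ) * x.coeff 1 := fun hx => by
      rw [hx.coeff_left hr, ← hx.coeff_right hc, one_mul]
    rw [key hx, key hy, h]
  · have key : ∀ {x : MonoidAlgebra ℂ (CellPerm lam)}, IsRowColInvariant x → x.coeff g = 0 := by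
      intro x hx
      have h1 := hx.coeff_left (isRowPerm_swap hrow) g
      have h2 : Equiv.swap a b * g = g * Equiv.swap (g⁻¹ a) (g⁻¹ b) :=
        Equiv.swap_mul_eq_mul_swap g a b
      rw [h2, hx.coeff_right (isColPerm_swap hcol), Perm.sign_swap (g⁻¹.injective.ne hab)] at h1
      have h3 : -x.coeff g = x.coeff g := by simpa using h1
      exact neg_eq_self.1 h3
    rw [key hx, key hy]

theorem isRowColInvariant_youngSymmetrizer : IsRowColInvariant (youngSymmetrizer lam) := by
  classical
  constructor
  · intro r hr
    rw [youngSymmetrizer, ← mul_assoc]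
    refine congrArg₂ (· * ·) ?_ rfl
    rw [mul_sum]
    refine sum_bij' (fun s _ => r * s) (fun s _ => r⁻¹ * s) ?_ ?_ ?_ ?_ ?_
    · intro s hs
      exact mem_filter.2 ⟨mem_univ _, hr.mul (mem_filter.1 hs).2⟩
    · intro s hs
      exact mem_filter.2 ⟨mem_univ _, hr.inv.mul (mem_filter.1 hs).2⟩
    · intro s _
      exact inv_mul_cancel_left r s
    · intro s _
      exact mul_inv_cancel_left r s
    · intro s _
      rw [MonoidAlgebra.single_mul_single, one_mul]
  · intro c hc
    rw [youngSymmetrizer, mul_assoc, ← mul_smul_comm]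
    refine congrArg₂ (· * ·) rfl ?_
    rw [sum_mul, smul_sum]
    refine sum_bij' (fun s _ => s * c) (fun s _ => s * c⁻¹) ?_ ?_ ?_ ?_ ?_
    · intro s hs
      exact mem_filter.2 ⟨mem_univ _, IsColPerm.mul (mem_filter.1 hs).2 hc⟩
    · intro s hs
      exact mem_filter.2 ⟨mem_univ _, IsColPerm.mul (mem_filter.1 hs).2 hc.inv⟩
    · intro s _
      exact mul_inv_cancel_right s c
    · intro s _
      exact inv_mul_cancel_right s c
    · intro s _
      rw [MonoidAlgebra.single_mul_single, mul_one, MonoidAlgebra.smul_single, smul_eq_mul,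
        Perm.sign_mul]
      congr 1
      rw [← Int.cast_mul, ← Units.val_mul, mul_comm (Perm.sign s), ← mul_assoc, Int.units_mul_self,
        one_mul]

theorem youngSymmetrizer_coeff_one : (youngSymmetrizer lam).coeff 1 = 1 := by
  classical
  rw [youngSymmetrizer, sum_mul_sum, MonoidAlgebra.coeff_sum, Finsupp.finsetSum_apply,
    sum_eq_single 1]
  · rw [MonoidAlgebra.coeff_sum, Finsupp.finsetSum_apply, sum_eq_single 1]
    · simp
    · intro c _ hc
      rw [MonoidAlgebra.single_mul_single, one_mul, MonoidAlgebra.coeff_single,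
        Finsupp.single_apply, if_neg hc]
    · intro h
      exact absurd (mem_filter.2 ⟨mem_univ _, fun _ => rfl⟩) h
  · intro r hr hr1
    rw [MonoidAlgebra.coeff_sum, Finsupp.finsetSum_apply]
    refine sum_eq_zero fun c hc => ?_
    rw [MonoidAlgebra.single_mul_single, MonoidAlgebra.coeff_single, Finsupp.single_apply, if_neg]
    intro h
    -- a permutation preserving both rows and columns is trivial
    have hcol : IsColPerm r := by
      rw [eq_inv_of_mul_eq_one_left h]
      exact IsColPerm.inv (mem_filter.1 hc).2
    exact hr1 (Equiv.ext fun x => Subtype.ext (Prod.ext ((mem_filter.1 hr).2 x) (hcol x)))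
  · intro h
    exact absurd (mem_filter.2 ⟨mem_univ _, fun _ => rfl⟩) h

theorem youngSymmetrizer_ne_zero : youngSymmetrizer lam ≠ 0 := fun h => by
  have := youngSymmetrizer_coeff_one (lam := lam)
  rw [h] at this
  simp at this

/-- Central elements of the group algebra act on the irreducible representation by scalars. -/
theorem exists_scalar {Z : MonoidAlgebra ℂ (CellPerm lam)} (hZ : ∀ y, Z * y = y * Z) :
    ∃ ω : ℂ, Algebra.lsmul ℂ ℂ (spechtModule lam) Z = ω • LinearMap.id := by
  have h1 := isRowColInvariant_youngSymmetrizer (lam := lam)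
  set ω := (Z * youngSymmetrizer lam).coeff 1
  have h2 : Z * youngSymmetrizer lam = ω • youngSymmetrizer lam := by
    refine IsRowColInvariant.eq ⟨fun r hr => ?_, fun c hc => ?_⟩ ⟨fun r hr => ?_, fun c hc => ?_⟩ ?_
    · rw [← mul_assoc, ← hZ, mul_assoc, h1.1 r hr]
    · rw [mul_assoc, h1.2 c hc, mul_smul_comm]
    · rw [mul_smul_comm, h1.1 r hr]
    · rw [smul_mul_assoc, h1.2 c hc, smul_comm]
    · rw [MonoidAlgebra.coeff_smul, Finsupp.smul_apply, youngSymmetrizer_coeff_one, smul_eq_mul,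
        mul_one]
  refine ⟨ω, LinearMap.ext fun y => Subtype.ext ?_⟩
  obtain ⟨y, hy⟩ := y
  obtain ⟨b, rfl⟩ := Ideal.mem_span_singleton'.1 hy
  change Z * (b * _) = ω • (b * _)
  rw [← mul_assoc, hZ, mul_assoc, h2, mul_smul_comm]

instance : Module.Finite ℂ (MonoidAlgebra ℂ (CellPerm lam)) :=
  Module.Finite.equiv (MonoidAlgebra.coeffLinearEquiv ℂ).symm

instance : Module.Finite ℂ (spechtModule lam) :=
  Module.Finite.of_injective
    ((spechtModule lam).subtype.restrictScalars ℂ) Subtype.val_injective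

theorem dimIrr_ne_zero : dimIrr lam ≠ 0 := by
  have : Nontrivial (spechtModule lam) :=
    ⟨⟨youngSymmetrizer lam, Ideal.mem_span_singleton_self _⟩, 0,
      fun h => youngSymmetrizer_ne_zero (congrArg Subtype.val h)⟩
  exact Module.finrank_pos.ne'

theorem chi_one : chi lam 1 = dimIrr lam := by
  rw [chi, ← MonoidAlgebra.one_def, map_one, LinearMap.trace_one, dimIrr]

/-- Sums of the character over cosets of a conjugacy class. -/
theorem sum_chi_mul (Δ : Ptn) (σ : CellPerm lam) [DecidablePred fun f : CellPerm lam =>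
      ctype univ f = Δ] :
    ∑ f : CellPerm lam with ctype univ f = Δ, chi lam (σ * f) =
      1 / (dimIrr lam : ℂ) * (∑ f : CellPerm lam with ctype univ f = Δ, chi lam f) *
        chi lam σ := by
  set Z : MonoidAlgebra ℂ (CellPerm lam) :=
    ∑ f : CellPerm lam with ctype univ f = Δ, MonoidAlgebra.single f 1 with hZdef
  have hZ : ∀ y, Z * y = y * Z := by
    intro y
    induction y using MonoidAlgebra.induction_linear with
    | zero => simp
    | add x y hx hy => rw [mul_add, add_mul, hx, hy]
    | single g t =>
      rw [hZdef, sum_mul, mul_sum]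
      refine sum_equiv (MulAut.conj g⁻¹).toEquiv (fun f => ?_) (fun f _ => ?_)
      · simp only [mem_filter, mem_univ, true_and]
        rw [(ctype_univ_eq_iff_isConj f _).2 (isConj_iff.2 ⟨g⁻¹, rfl⟩)]
        rfl
      · rw [MonoidAlgebra.single_mul_single, MonoidAlgebra.single_mul_single, one_mul, mul_one]
        congr 1
        change _ = g * (g⁻¹ * f * g⁻¹⁻¹)
        group
  obtain ⟨ω, hω⟩ := exists_scalar hZ
  have key : ∀ σ : CellPerm lam,
      ∑ f : CellPerm lam with ctype univ f = Δ, chi lam (σ * f) = ω * chi lam σ := by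
    intro σ
    have h1 : Algebra.lsmul ℂ ℂ (spechtModule lam) (MonoidAlgebra.single σ (1 : ℂ) * Z) =
        ω • Algebra.lsmul ℂ ℂ (spechtModule lam) (MonoidAlgebra.single σ (1 : ℂ)) := by
      rw [map_mul, hω, mul_smul_comm]
      rfl
    have h2 := congrArg (LinearMap.trace ℂ (spechtModule lam)) h1
    rw [hZdef, mul_sum, map_sum, map_sum, map_smul, smul_eq_mul] at h2
    simp only [MonoidAlgebra.single_mul_single, mul_one] at h2
    exact h2
  have h1 := key 1
  simp only [one_mul] at h1
  rw [key, h1, chi_one]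
  have : (dimIrr lam : ℂ) ≠ 0 := Nat.cast_ne_zero.2 dimIrr_ne_zero
  field_simp

end YoungSymmetrizer

/-! ### The representation of the limit algebra and its eigenvectors -/

section Representation

variable {R : Type*} [CommRing R]

theorem coeff_zMon (z : Rˣ) (Γ Δ : Ptn) [Decidable (Γ = Δ)] :
    (zMon z Γ).coeff (Multiset.toFinsupp Δ) =
      if Γ = Δ then ((z ^ (-(Δ.card : ℤ)) : Rˣ) : R) else 0 := by
  classical
  rw [zMon, pMon_eq_monomial, MvPolynomial.coeff_smul, MvPolynomial.coeff_monomial]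
  by_cases h : Γ = Δ
  · subst h
    simp
  · rw [if_neg (fun h' => h (Multiset.toFinsupp.injective h')), if_neg h, smul_zero]

theorem end_ext (z : Rˣ) {A B : Module.End R (MvPolynomial ℕ+ R)}
    (h : ∀ Γ, A (zMon z Γ) = B (zMon z Γ)) : A = B := by
  refine (MvPolynomial.basisMonomials ℕ+ R).ext fun m => ?_
  have h1 : MvPolynomial.monomial m (1 : R) =
      ((z ^ ((Finsupp.toMultiset m).card : ℤ) : Rˣ) : R) • zMon z (Finsupp.toMultiset m) := by
    rw [zMon, smul_smul, ← Units.val_mul, ← zpow_add, add_neg_cancel, zpow_zero, Units.val_one,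
      one_smul, pMon_eq_monomial, Finsupp.toMultiset_toFinsupp]
  rw [MvPolynomial.coe_basisMonomials]
  simp only [h1]
  rw [map_smul, map_smul, h]

variable [Algebra ℂ R]

theorem exists_ctype_univ (Γ : Ptn) :
    ∃ s : Perm {x // x ∈ range (size Γ)}, ctype univ s = Γ := by
  obtain ⟨a, ha⟩ := exists_isOfType Γ
  refine ⟨toPerm _ a, ?_⟩
  rw [isOfType_iff] at ha
  have h : toSupp a = univ := eq_univ_of_card _ (by
    rw [Fintype.card_coe, card_range, ← size_ctype (support_toPerm_subset a), ha])
  rwa [h] at ha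

theorem linearCombination_mul {G M : Type*} [Monoid G] [AddCommGroup M] [Module ℂ M] (F : G → M)
    (x y : MonoidAlgebra ℂ G) : Finsupp.linearCombination ℂ F (x * y).coeff =
      Finsupp.linearCombination ℂ (fun a => Finsupp.linearCombination ℂ (fun b => F (a * b))
        y.coeff) x.coeff := by
  induction x using MonoidAlgebra.induction_linear with
  | zero => simp
  | add x x' hx hx' => rw [add_mul, MonoidAlgebra.coeff_add, MonoidAlgebra.coeff_add, map_add,
      map_add, hx, hx']
  | single a r =>
    rw [MonoidAlgebra.coeff_single, Finsupp.linearCombination_single]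
    induction y using MonoidAlgebra.induction_linear with
    | zero => simp
    | add y y' hy hy' => rw [mul_add, MonoidAlgebra.coeff_add, MonoidAlgebra.coeff_add, map_add,
        map_add, smul_add, hy, hy']
    | single b t =>
      rw [MonoidAlgebra.single_mul_single, MonoidAlgebra.coeff_single, MonoidAlgebra.coeff_single,
        Finsupp.linearCombination_single, Finsupp.linearCombination_single, smul_smul]

/-- The representation of `A_∞` on the polynomials, as a linear map. -/
def actLin (z : Rˣ) : AInf →ₗ[ℂ] Module.End R (MvPolynomial ℕ+ R) :=
  basisAInf.constr ℂ (What z)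

theorem actLin_AElt (z : Rˣ) (Δ : Ptn) : actLin z (AElt Δ) = What z Δ := by
  rw [actLin, ← basisAInf_apply, Module.Basis.constr_basis]

/-- In degree `n` the algebra `A_∞` acts through the multiplication in the group algebra of
`S_n`. -/
theorem actLin_zMon (z : Rˣ) (x : AInf) {n : ℕ} (s : Perm {x // x ∈ range n}) :
    actLin z x (zMon z (ctype univ s)) = Finsupp.linearCombination ℂ
      (fun a : PP n => zMon z (ctype univ (s * toPerm n a))) (x.1 n).coeff := by
  classical
  let L₁ : AInf →ₗ[ℂ] MvPolynomial ℕ+ R :=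
    { toFun := fun x => actLin z x (zMon z (ctype univ s))
      map_add' := fun x y => by rw [map_add, LinearMap.add_apply]
      map_smul' := fun c x => by rw [map_smul, LinearMap.smul_apply, RingHom.id_apply] }
  let L₂ : AInf →ₗ[ℂ] MvPolynomial ℕ+ R :=
    { toFun := fun x => Finsupp.linearCombination ℂ
        (fun a : PP n => zMon z (ctype univ (s * toPerm n a))) (x.1 n).coeff
      map_add' := fun x y => by
        rw [← map_add]
        rfl
      map_smul' := fun c x => by
        rw [RingHom.id_apply, ← map_smul]
        rfl }
  suffices h : L₁ = L₂ from congrArg (fun L => L x) h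
  refine basisAInf.ext fun Δ => ?_
  change actLin z (basisAInf Δ) _ = Finsupp.linearCombination ℂ _ ((basisAInf Δ).1 n).coeff
  rw [basisAInf_apply, actLin_AElt, What_zMon_ctype, Fintype.card_coe, card_range]
  have h1 : ((AElt Δ).1 n).coeff = ∑ a : PP n with a.1.IsOfType Δ, Finsupp.single a 1 :=
    MonoidAlgebra.coeff_sum _ _
  rw [h1, map_sum]
  simp only [Finsupp.linearCombination_single, one_smul]
  exact (sum_isOfType n Δ fun f => zMon z (ctype univ (s * f))).symm

theorem actLin_one (z : Rˣ) : actLin z 1 = 1 := by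
  refine end_ext z fun Γ => ?_
  obtain ⟨s, hs⟩ := exists_ctype_univ Γ
  rw [← hs, actLin_zMon]
  change Finsupp.linearCombination ℂ _ (1 : BAlg _).coeff = _
  rw [MonoidAlgebra.one_def, MonoidAlgebra.coeff_single, Finsupp.linearCombination_single,
    one_smul, map_one, mul_one]
  rfl

theorem actLin_mul (z : Rˣ) (x y : AInf) : actLin z (x * y) = actLin z x * actLin z y := by
  refine end_ext z fun Γ => ?_
  obtain ⟨s, hs⟩ := exists_ctype_univ Γ
  -- the operators multiply from the right, so that the factors have to be exchanged
  rw [← hs, AInf_mul_comm, Module.End.mul_apply, actLin_zMon, actLin_zMon]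
  have h1 := linearCombination_mul
    (fun a : PP (size Γ) => zMon z (ctype univ (s * toPerm _ a))) (y.1 _) (x.1 _)
  have h2 := Finsupp.apply_linearCombination ℂ ((actLin z x).restrictScalars ℂ)
    (fun a : PP (size Γ) => zMon z (ctype univ (s * toPerm _ a))) (y.1 _).coeff
  have h3 : ∀ b : PP (size Γ), Finsupp.linearCombination ℂ
      (fun a => zMon z (ctype univ (s * toPerm _ (b * a)))) (x.1 _).coeff =
      actLin z x (zMon z (ctype univ (s * toPerm _ b))) := fun b => by
    rw [actLin_zMon]
    simp only [map_mul, mul_assoc]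
  exact (h1.trans (congrArg (fun F => Finsupp.linearCombination ℂ F _) (funext h3))).trans h2.symm

/-- The representation of `A_∞` on the polynomials. -/
def act (z : Rˣ) : AInf →ₐ[ℂ] Module.End R (MvPolynomial ℕ+ R) :=
  AlgHom.ofLinearMap (actLin z) (actLin_one z) (actLin_mul z)

theorem act_AElt (z : Rˣ) (Δ : Ptn) : act z (AElt Δ) = What z Δ := actLin_AElt z Δ

/-- The representation is faithful: in the image of `p_1^n` one sees the coefficients of the
partial permutations of minimal degree `n`. -/
theorem act_injective [Nontrivial R] (z : Rˣ) : Function.Injective (act (R := R) z) := by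
  classical
  refine (injective_iff_map_eq_zero _).2 fun x hx => ?_
  have key : ∀ n, ∀ Δ, size Δ = n → typeCoeff Δ x.1 = 0 := by
    intro n
    induction n using Nat.strong_induction_on with
    | _ n ih =>
    intro Δ hΔ
    have h1 := actLin_zMon z x (1 : Perm {x // x ∈ range n})
    rw [show actLin z x = 0 from hx, LinearMap.zero_apply, Finsupp.linearCombination_apply,
      Finsupp.sum_fintype _ _ (by intro i; exact zero_smul ℂ _)] at h1
    have h2 := congrArg (MvPolynomial.coeff (Multiset.toFinsupp Δ)) h1
    rw [MvPolynomial.coeff_zero, MvPolynomial.coeff_sum] at h2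
    have h3 : ∀ a : PP n, MvPolynomial.coeff (Multiset.toFinsupp Δ)
        ((x.1 n).coeff a • zMon z (ctype univ (1 * toPerm n a))) =
          if a.1.IsOfType Δ then typeCoeff Δ x.1 • ((z ^ (-(Δ.card : ℤ)) : Rˣ) : R) else 0 := by
      intro a
      rw [MvPolynomial.coeff_smul, coeff_zMon, one_mul]
      by_cases ha : (toSupp a) = univ
      · rw [isOfType_iff, ha]
        split_ifs with h
        · rw [coeff_eq_typeCoeff x.2 (Δ := Δ) ((isOfType_iff a Δ).2 (by rwa [ha]))]
        · rw [smul_zero]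
      · have hlt : #(toSupp a) < n := by
          have := card_lt_univ_of_notMem (s := toSupp a)
            (not_forall.1 (fun h => ha (eq_univ_iff_forall.2 h))).choose_spec
          rwa [Fintype.card_coe, card_range] at this
        have hty := (isOfType_iff a _).2 rfl
        have hsz := size_ctype (support_toPerm_subset a)
        rw [coeff_eq_typeCoeff x.2 hty, ih _ hlt _ hsz, zero_smul, if_neg]
        intro h
        rw [isOfType_unique hty h, hΔ] at hsz
        exact hlt.ne hsz.symm
    rw [sum_congr rfl fun a _ => h3 a, ← sum_filter, sum_const, ← Nat.cast_smul_eq_nsmul ℂ,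
      smul_smul] at h2
    obtain ⟨a, ha⟩ := exists_isOfType Δ
    subst hΔ
    have hpos : (#{a : PP (size Δ) | a.1.IsOfType Δ} : ℂ) ≠ 0 :=
      Nat.cast_ne_zero.2 (card_ne_zero.2 ⟨a, mem_filter.2 ⟨mem_univ _, ha⟩⟩)
    by_contra h0
    have h4 := congrArg (fun r : R => (((#{a : PP (size Δ) | a.1.IsOfType Δ} : ℂ) *
      typeCoeff Δ x.1)⁻¹) • r) h2.symm
    simp only [smul_zero] at h4
    rw [inv_smul_smul₀ (mul_ne_zero hpos h0)] at h4
    exact Units.ne_zero _ h4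
  refine Subtype.ext (funext fun n => MonoidAlgebra.coeff_injective (Finsupp.ext fun a => ?_))
  obtain ⟨Δ, hΔ⟩ := exists_ptn_isOfType a
  rw [coeff_eq_typeCoeff x.2 hΔ, key _ Δ rfl]
  rfl

theorem range_act_eq_span (z : Rˣ) : Subalgebra.toSubmodule (act (R := R) z).range =
    Submodule.span ℂ (Set.range (What z)) := by
  rw [← Module.Basis.constr_range basisAInf (S := ℂ)]
  rfl

theorem WInf_eq_range (z : Rˣ) : WInf z = (act (R := R) z).range := by
  refine le_antisymm (Algebra.adjoin_le ?_) fun y hy => ?_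
  · rintro _ ⟨Δ, rfl⟩
    exact ⟨AElt Δ, act_AElt z Δ⟩
  · have h : y ∈ Submodule.span ℂ (Set.range (What z)) := by
      rw [← range_act_eq_span]
      exact hy
    exact Algebra.span_le_adjoin ℂ _ h

theorem What_mul_What (z : Rˣ) (Δ₁ Δ₂ : Ptn) : What z Δ₁ * What z Δ₂ =
    (basisAInf.repr (AElt Δ₁ * AElt Δ₂)).sum fun Δ₃ c => c • What z Δ₃ := by
  rw [← actLin_AElt, ← actLin_AElt, ← actLin_mul, actLin, Module.Basis.constr_apply]

/-- The isomorphism of `W_∞` with `A_∞`. -/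
def WInfEquiv [Nontrivial R] (z : Rˣ) : WInf (R := R) z ≃ₐ[ℂ] AInf :=
  (Subalgebra.equivOfEq _ _ (WInf_eq_range z)).trans
    (AlgEquiv.ofInjective _ (act_injective z)).symm

theorem WInfEquiv_What [Nontrivial R] (z : Rˣ) (Δ : Ptn) :
    WInfEquiv z ⟨What z Δ, What_mem z Δ⟩ = AElt Δ := by
  rw [WInfEquiv, AlgEquiv.trans_apply, AlgEquiv.symm_apply_eq]
  exact Subtype.ext (act_AElt z Δ).symm

end Representation

section Schur

variable {R : Type*} [CommRing R] [Algebra ℂ R] (lam : YoungDiagram)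

theorem card_cells : Fintype.card {c // c ∈ lam.cells} = lam.card := Fintype.card_coe _

open Classical in
theorem phi_eq (Δ : Ptn) : phi lam Δ = (shiftBinom lam.card Δ : ℂ) * (1 / (dimIrr lam : ℂ)) *
    ∑ σ : CellPerm lam with ctype univ σ = shift lam.card Δ, chi lam σ := by
  rw [phi]
  split_ifs with h
  · simp only [hasType_iff]
  · rw [sum_eq_zero, mul_zero]
    intro σ hσ
    have h1 := congrArg size (mem_filter.1 hσ).2
    rw [size_ctype_univ, shift, size_add, card_cells] at h1
    omega

/-- The image of `∑ χ_λ(σ) σ` in the polynomials. -/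
def charImage (z : Rˣ) : MvPolynomial ℕ+ R :=
  ∑ σ : CellPerm lam, chi lam σ • zMon z (ctype univ σ)

theorem genusSchur_eq (z : Rˣ) : genusSchur z lam =
    ((z ^ (-(lam.card : ℤ)) : Rˣ) : R) • (1 / (lam.card ! : ℂ)) • charImage lam z := by
  classical
  rw [genusSchur, charImage, ← sum_fiberwise_of_maps_to (s := univ)
    (t := (size_finite lam.card).toFinset.filter fun Γ => size Γ = lam.card)
    (g := fun σ : CellPerm lam => ctype univ σ), smul_sum, smul_sum]
  · refine sum_congr rfl fun Γ hΓ => ?_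
    have hsz := (mem_filter.1 hΓ).2
    rw [sum_congr rfl (g := fun σ => chi lam σ • zMon z Γ)
      (fun σ hσ => by rw [(mem_filter.1 hσ).2]), ← sum_smul, phi_eq, ← hsz, shift_size,
      shiftBinom_size, zMon, sub_eq_add_neg, zpow_add, Units.val_mul]
    have hd : (dimIrr lam : ℂ) ≠ 0 := Nat.cast_ne_zero.2 dimIrr_ne_zero
    rw [smul_comm (_ : ℂ) (_ : R) (pMon R Γ), smul_comm (_ : ℂ) (_ : R) (_ • pMon R Γ), smul_smul,
      smul_smul]
    congr 2
    push_cast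
    field_simp
  · intro σ _
    refine mem_filter.2 ⟨(size_finite _).mem_toFinset.2 ?_, ?_⟩
    · exact (size_ctype_univ σ).trans_le (card_cells lam).le
    · rw [size_ctype_univ, card_cells]

theorem What_charImage (z : Rˣ) (Δ : Ptn) :
    What z Δ (charImage lam z) = phi lam Δ • charImage lam z := by
  classical
  set C : Finset (CellPerm lam) := {f | ctype univ f = shift lam.card Δ} with hC
  have hinv : ∀ τ : CellPerm lam, ∑ f ∈ C, chi lam (τ * f⁻¹) = ∑ f ∈ C, chi lam (τ * f) :=
    fun τ => sum_equiv (Equiv.inv _) (fun f => by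
      simp only [hC, mem_filter, mem_univ, true_and, Equiv.inv_apply, ctype_inv]) fun f _ => rfl
  have h1 : What z Δ (charImage lam z) = ∑ σ : CellPerm lam, ∑ f ∈ C,
      ((shiftBinom lam.card Δ : ℂ) * chi lam σ) • zMon z (ctype univ (σ * f)) := by
    rw [charImage, map_sum]
    refine sum_congr rfl fun σ _ => ?_
    rw [LinearMap.map_smul_of_tower, What_zMon_ctype, card_cells, smul_smul, mul_comm, smul_sum]
  have h2 : ∀ f : CellPerm lam, ∑ σ : CellPerm lam,
      ((shiftBinom lam.card Δ : ℂ) * chi lam σ) • zMon z (ctype univ (σ * f)) =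
      ∑ τ : CellPerm lam,
        ((shiftBinom lam.card Δ : ℂ) * chi lam (τ * f⁻¹)) • zMon z (ctype univ τ) :=
    fun f => sum_equiv (Equiv.mulRight f) (by simp) fun σ _ => by simp
  rw [h1, sum_comm, sum_congr rfl fun f _ => h2 f, sum_comm, charImage, smul_sum]
  refine sum_congr rfl fun τ _ => ?_
  rw [← sum_smul, ← mul_sum, hinv, sum_chi_mul, smul_smul, phi_eq]
  congr 1
  ring

theorem charImage_ne_zero [Nontrivial R] (z : Rˣ) : charImage (R := R) lam z ≠ 0 := by
  classical
  intro h
  have h1 := congrArg (MvPolynomial.coeff (Multiset.toFinsupp (ctype univ (1 : CellPerm lam)))) h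
  rw [charImage, MvPolynomial.coeff_sum, sum_eq_single 1] at h1
  · rw [MvPolynomial.coeff_smul, coeff_zMon, if_pos rfl, MvPolynomial.coeff_zero, chi_one] at h1
    have hd : (dimIrr lam : ℂ) ≠ 0 := Nat.cast_ne_zero.2 dimIrr_ne_zero
    have h2 := congrArg (fun r : R => (dimIrr lam : ℂ)⁻¹ • r) h1.symm
    simp only [smul_zero] at h2
    rw [inv_smul_smul₀ hd] at h2
    exact Units.ne_zero _ h2.symm
  · intro σ _ hσ
    rw [MvPolynomial.coeff_smul, coeff_zMon, if_neg, smul_zero]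
    intro h
    obtain ⟨w, hw⟩ := isConj_iff.1 ((ctype_univ_eq_iff_isConj _ _).1 h.symm)
    exact hσ (by rw [← hw, mul_one, mul_inv_cancel])
  · intro h
    exact absurd (mem_univ _) h

theorem genusSchur_ne_zero [Nontrivial R] (z : Rˣ) : genusSchur (R := R) z lam ≠ 0 := by
  rw [genusSchur_eq]
  intro h
  have h1 := ((z ^ (-(lam.card : ℤ))).isUnit.smul_eq_zero).1 h
  have h2 : (1 / (lam.card ! : ℂ)) ≠ 0 :=
    one_div_ne_zero (Nat.cast_ne_zero.2 (Nat.factorial_ne_zero _))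
  have h3 := congrArg (fun r => (1 / (lam.card ! : ℂ))⁻¹ • r) h1
  simp only [smul_zero] at h3
  rw [inv_smul_smul₀ h2] at h3
  exact charImage_ne_zero lam z h3

theorem What_genusSchur (z : Rˣ) (Δ : Ptn) :
    What z Δ (genusSchur z lam) = phi lam Δ • genusSchur z lam := by
  rw [genusSchur_eq, map_smul, LinearMap.map_smul_of_tower, What_charImage,
    smul_comm (phi lam Δ) (_ : R), smul_comm (phi lam Δ) (_ : ℂ)]

end Schur

end

end ShiftedW

theorem corollary4p6 :
    ∃ b : Module.Basis ShiftedW.Ptn ℂ ShiftedW.AInf, (∀ Δ, b Δ = ShiftedW.AElt Δ) ∧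
      ∀ (R : Type*) [CommRing R] [Nontrivial R] [Algebra ℂ R] (z : Rˣ),
        Subalgebra.toSubmodule (ShiftedW.WInf z) =
            Submodule.span ℂ (Set.range (ShiftedW.What z)) ∧
        (∀ x y : ShiftedW.WInf z, x * y = y * x) ∧
        (∀ Δ₁ Δ₂ : ShiftedW.Ptn,
          ShiftedW.What z Δ₁ * ShiftedW.What z Δ₂ =
            (b.repr (ShiftedW.AElt Δ₁ * ShiftedW.AElt Δ₂)).sum
              fun Δ₃ c => c • ShiftedW.What z Δ₃) ∧
        (∃ e : ShiftedW.WInf z ≃ₐ[ℂ] ShiftedW.AInf,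
          ∀ Δ, e ⟨ShiftedW.What z Δ, ShiftedW.What_mem z Δ⟩ = ShiftedW.AElt Δ) ∧
        ∀ lam : YoungDiagram, ShiftedW.genusSchur z lam ≠ 0 ∧
          ∀ Δ, ShiftedW.What z Δ (ShiftedW.genusSchur z lam) =
            ShiftedW.phi lam Δ • ShiftedW.genusSchur z lam := by
  refine ⟨ShiftedW.basisAInf, ShiftedW.basisAInf_apply, fun R _ _ _ z => ?_⟩
  refine ⟨?_, fun x y => ?_, ShiftedW.What_mul_What z,
    ⟨ShiftedW.WInfEquiv z, ShiftedW.WInfEquiv_What z⟩,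
    fun lam => ⟨ShiftedW.genusSchur_ne_zero lam z, ShiftedW.What_genusSchur lam z⟩⟩
  · rw [ShiftedW.WInf_eq_range, ShiftedW.range_act_eq_span]
  · apply (ShiftedW.WInfEquiv z).injective
    rw [map_mul, map_mul, ShiftedW.AInf_mul_comm]
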